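/- Let $n\ge 4$ and let $\overline W_n(\mathbb R)$ be the real Lie algebra of all vector fields $f_1\frac{\partial}{\partial x_1}+\dots+f_n\frac{\partial}{\partial x_n}$ on $\mathbb R^n$ whose coefficients $f_i$ are real-analytic functions on $\mathbb R^n$, with bracket $[D_1,D_2]=D_1D_2-D_2D_1$. Then the problem of classifying the finite-dimensional nilpotent subalgebras of $\overline W_n(\mathbb R)$ up to isomorphism of Lie algebras is wild, that is, it contains the problem of classifying pairs $(A,B)$ of real square matrices of the same size up to similarity $(A,B)\mapsto(S^{-1}AS,S^{-1}BS)$, in the following sense. There are integers $r,s,h\ge 0$, linearly independent elements $c_i$ ($1\le i\le r$) and $X_{l,q}$ ($1\le l\le h$, $q\in\{1,2,\dots\}$) of $\overline W_n(\mathbb R)$, and an $h\times s$ matrix $T=[T_{lj}]$ of polynomials in two noncommuting variables with real coefficients, such that the following holds for every $m\ge 0$. For real $m\times m$ matrices $A,B$, let $L(A,B)$ be the linear span of $c_1,\dots,c_r$ and of the $sm$ vector fields $$\sum_{l=1}^{h}\sum_{q=1}^{m}\big(T_{lj}(A,B)\big)_{qk}\,X_{l,q}\qquad(1\le j\le s,\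 1\le k\le m),$$ whose coordinates are the columns of the block matrix $[T_{lj}(A,B)]$. Then these $r+sm$ vector fields are linearly independent, $L(A,B)$ is a nilpotent subalgebra of $\overline W_n(\mathbb R)$, and for all pairs $(A,B)$ and $(A',B')$ of real $m\times m$ matrices, $L(A,B)$ and $L(A',B')$ are isomorphic Lie algebras if and only if $(A,B)$ and $(A',B')$ are similar. -/

import Mathlib

/-- The real vector space of all vector fields `X = ∑ fᵢ ∂/∂xᵢ` on `ℝⁿ` with analytic coefficients:
such a field is written as the map `x ↦ (f₁ x, …, fₙ x)`, analytic at every point of `ℝⁿ`. -/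
def analyticVectorFields (n : ℕ) : Submodule ℝ ((Fin n → ℝ) → (Fin n → ℝ)) where
  carrier := {X | AnalyticOnNhd ℝ X Set.univ}
  add_mem' := fun hX hY => hX.add hY
  zero_mem' := analyticOnNhd_const
  smul_mem' := fun _ _ hX x hx => (hX x hx).const_smul

/-- The Lie algebra of all vector fields on `ℝⁿ` with analytic coefficients. -/
abbrev AnalyticVectorField (n : ℕ) : Type := analyticVectorFields n

namespace AnalyticVectorField

variable {n : ℕ}

theorem analyticOnNhd (X : AnalyticVectorField n) :
    AnalyticOnNhd ℝ (X : (Fin n → ℝ) → (Fin n → ℝ)) Set.univ := X.2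

theorem contDiffAt (X : AnalyticVectorField n) (k : WithTop ℕ∞) (x : Fin n → ℝ) :
    ContDiffAt ℝ k (X : (Fin n → ℝ) → (Fin n → ℝ)) x :=
  (X.2 x (Set.mem_univ x)).contDiffAt

theorem differentiableAt (X : AnalyticVectorField n) (x : Fin n → ℝ) :
    DifferentiableAt ℝ (X : (Fin n → ℝ) → (Fin n → ℝ)) x :=
  (X.2 x (Set.mem_univ x)).differentiableAt

/-- The bracket of vector fields: `[X, Y] x = Y'(x) (X x) - X'(x) (Y x)`; as differential operators
this is `[X, Y] = XY - YX`. -/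
noncomputable instance : Bracket (AnalyticVectorField n) (AnalyticVectorField n) where
  bracket X Y := ⟨VectorField.lieBracket ℝ X.1 Y.1,
    fun x _ => ContDiffAt.analyticAt
      ((X.contDiffAt ⊤ x).lieBracket_vectorField (Y.contDiffAt ⊤ x) (by simp))⟩

theorem coe_bracket (X Y : AnalyticVectorField n) :
    ((⁅X, Y⁆ : AnalyticVectorField n) : (Fin n → ℝ) → (Fin n → ℝ)) =
      VectorField.lieBracket ℝ X.1 Y.1 := rfl

noncomputable instance : LieRing (AnalyticVectorField n) where
  add_lie X Y Z := by
    ext1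
    funext x
    exact VectorField.lieBracket_add_left (X.differentiableAt x) (Y.differentiableAt x)
  lie_add X Y Z := by
    ext1
    funext x
    exact VectorField.lieBracket_add_right (Y.differentiableAt x) (Z.differentiableAt x)
  lie_self X := by
    ext1
    exact VectorField.lieBracket_self
  leibniz_lie X Y Z := by
    ext1
    funext x
    exact VectorField.leibniz_identity_lieBracket (𝕜 := ℝ) le_rfl
      (X.contDiffAt _ x) (Y.contDiffAt _ x) (Z.contDiffAt _ x)

noncomputable instance : LieAlgebra ℝ (AnalyticVectorField n) where
  lie_smul c X Y := by
    ext1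
    funext x
    exact VectorField.lieBracket_const_smul_right (Y.differentiableAt x)

end AnalyticVectorField

/-- Similarity of pairs of square matrices: `(A', B') = (S⁻¹ A S, S⁻¹ B S)` with `S` nonsingular. -/
def PairSimilar {F : Type*} [Field F] {m : ℕ} (A B A' B' : Matrix (Fin m) (Fin m) F) : Prop :=
  ∃ S : Matrix (Fin m) (Fin m) F, IsUnit S.det ∧ A' = S⁻¹ * A * S ∧ B' = S⁻¹ * B * S

/-- The value `p(A, B)` of a polynomial `p(x, y)` in two noncommuting variables at a pair of
square matrices. -/
def ncEval {F : Type*} [Field F] {m : ℕ} (A B : Matrix (Fin m) (Fin m) F) :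
    FreeAlgebra F (Fin 2) →ₐ[F] Matrix (Fin m) (Fin m) F :=
  FreeAlgebra.lift F ![A, B]

/-- A family of systems of vectors in `L`, parametrized by the pairs `(A, B)` of square matrices of
the same, arbitrary, size `m` and given by a single matrix `T(x, y)` of noncommutative polynomials.

The vectors are described by their coordinates in the linearly independent system that consists of
the `c i` and the `X l q`.  The system at `(A, B)` consists of the `r` constant vectors `c i`, and
of the `s * m` vectors whose coordinates in the `X l q` with `q < m` are the columns of the block
matrix `T(A, B) = [T l j (A, B)]`, with blocks of size `m × m`. -/
structure NCFamily (F L : Type*) [Field F] [AddCommGroup L] [Module F L] where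
  (r s h : ℕ)
  c : Fin r → L
  X : Fin h → ℕ → L
  indep : LinearIndependent F (Sum.elim c (fun lq : Fin h × ℕ => X lq.1 lq.2))
  T : Matrix (Fin h) (Fin s) (FreeAlgebra F (Fin 2))

/-- The vectors of the family at the pair `(A, B)`. -/
def NCFamily.vec {F L : Type*} [Field F] [AddCommGroup L] [Module F L] (Φ : NCFamily F L)
    {m : ℕ} (A B : Matrix (Fin m) (Fin m) F) : Fin Φ.r ⊕ (Fin Φ.s × Fin m) → L :=
  Sum.elim Φ.c
    (fun jk => ∑ l : Fin Φ.h, ∑ q : Fin m, ncEval A B (Φ.T l jk.1) q jk.2 • Φ.X l q)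

/-- The problem of classifying, up to isomorphism of Lie algebras, the finite-dimensional nilpotent
subalgebras of the Lie algebra `L` is *wild*: it contains the problem of classifying pairs of square
matrices of the same size up to similarity.  That is, there is a family given by noncommutative
polynomials in the pair `(A, B)` that sends each pair to a basis of a (thus finite-dimensional)
nilpotent subalgebra of `L` such that two pairs are similar if and only if the corresponding
subalgebras are isomorphic. -/
def NilpotentSubalgebraProblemIsWild (F L : Type*) [Field F] [LieRing L] [LieAlgebra F L] : Prop :=
  ∃ (Φ : NCFamily F L)
    (g : ∀ m : ℕ, Matrix (Fin m) (Fin m) F → Matrix (Fin m) (Fin m) F → LieSubalgebra F L),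
    (∀ (m : ℕ) (A B : Matrix (Fin m) (Fin m) F),
      LinearIndependent F (Φ.vec A B) ∧
      (g m A B).toSubmodule = Submodule.span F (Set.range (Φ.vec A B)) ∧
      LieRing.IsNilpotent (g m A B)) ∧
    ∀ (m : ℕ) (A B A' B' : Matrix (Fin m) (Fin m) F),
      PairSimilar A B A' B' ↔ Nonempty (g m A B ≃ₗ⁅F⁆ g m A' B')

/-! The fields `∂/∂x`, `∂/∂y` and `xⁱ/i! * yʲ/j! * zᵏ ∂/∂w` span a model of power series in `x, y`
acted on by two commuting derivations. The powers of `z` supply an infinite-dimensional space of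
coefficients, so any finite-dimensional coefficient space fits.

A pair `(A, B)` is first encoded by the quintuple of subspaces of `F^m ⊕ F^m` consisting of all `(v,
0)`, `(0, v)`, `(v, v)`, `(v, Av)`, `(v, Bv)`. An injective map respecting the first three is of the
form `P ⊕ P`, and the last two then give `PA = A'P` and `PB = B'P`
(`pairSimilar_of_map_range_pencilMap`).

The quintuple is then encoded in a nilpotent Lie algebra `pairAlgebra A B`: polynomials of degree at
most 4 with vector coefficients, where the coefficient of `x^(4-k) y^k` is confined to the `k`-th
subspace, extended by the two derivations. To keep an isomorphism from mixing the derivations, one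
more scalar coefficient is added, with the monomials dividing `x⁴y` or `y⁵`.

Modulo series, an isomorphism preserves the line of `∂/∂x`, because `(∂/∂x)⁵` kills every series
while an operator with a `∂/∂y` term does not kill `y⁵` in its fifth power. It also preserves the
line of `∂/∂y`, by testing on `x⁴y` (`map_pairAlgebraDy_dx`). It therefore rescales the derivations
on series (`exists_map_series_eq`). On constant series modulo the scalar line it respects the five
subspaces, which are reached by applying `(∂/∂x)^(4-k) (∂/∂y)^k`. -/

namespace AnalyticVectorField

open scoped Nat

variable {n : ℕ}

/-! ### Monomial vector fields: brackets and linear independence. -/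

/-- The coordinate vector field `∂/∂xₐ`. -/
def partialField (a : Fin n) : AnalyticVectorField n :=
  ⟨fun _ => Pi.single a 1, analyticOnNhd_const⟩

/-- The vector field `f ∂/∂xₐ`. -/
def funField (a : Fin n) (f : (Fin n → ℝ) → ℝ) (hf : AnalyticOnNhd ℝ f Set.univ) :
    AnalyticVectorField n :=
  ⟨fun p => f p • Pi.single a 1, fun x hx => (hf x hx).smul analyticAt_const⟩

theorem partialField_lie_partialField (a b : Fin n) : ⁅partialField a, partialField b⁆ = 0 := by
  ext1
  funext p
  simp [coe_bracket, VectorField.lieBracket, partialField]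

theorem fderiv_smul_const_apply {f : (Fin n → ℝ) → ℝ} (hf : AnalyticOnNhd ℝ f Set.univ)
    (v p w : Fin n → ℝ) : fderiv ℝ (fun p => f p • v) p w = fderiv ℝ f p w • v := by
  rw [fderiv_smul_const (hf p (Set.mem_univ p)).differentiableAt]
  rfl

theorem partialField_lie_funField (a b : Fin n) {f g : (Fin n → ℝ) → ℝ}
    (hf : AnalyticOnNhd ℝ f Set.univ) (hg : AnalyticOnNhd ℝ g Set.univ)
    (h : ∀ p, fderiv ℝ f p (Pi.single a 1) = g p) :
    ⁅partialField a, funField b f hf⁆ = funField b g hg := by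
  ext1
  funext p
  simp only [coe_bracket, VectorField.lieBracket, partialField, funField]
  rw [fderiv_smul_const_apply hf, h]
  simp

theorem funField_lie_funField (b : Fin n) {f g : (Fin n → ℝ) → ℝ}
    (hf : AnalyticOnNhd ℝ f Set.univ) (hg : AnalyticOnNhd ℝ g Set.univ)
    (hf' : ∀ p, fderiv ℝ f p (Pi.single b 1) = 0) (hg' : ∀ p, fderiv ℝ g p (Pi.single b 1) = 0) :
    ⁅funField b f hf, funField b g hg⁆ = 0 := by
  ext1
  funext p
  simp only [coe_bracket, VectorField.lieBracket, funField]
  rw [fderiv_smul_const_apply hf, fderiv_smul_const_apply hg, map_smul, map_smul, hf', hg']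
  simp

/-- The function `x₀ⁱ / i! * x₁ʲ / j! * x₂ᵏ`. -/
noncomputable def dividedMonomial (x y z : Fin n) (i j k : ℕ) (p : Fin n → ℝ) : ℝ :=
  p x ^ i / i ! * (p y ^ j / j !) * p z ^ k

theorem analyticOnNhd_eval (a : Fin n) :
    AnalyticOnNhd ℝ (fun p : Fin n → ℝ => p a) Set.univ :=
  (ContinuousLinearMap.proj a : (Fin n → ℝ) →L[ℝ] ℝ).analyticOnNhd _

theorem analyticOnNhd_dividedMonomial (x y z : Fin n) (i j k : ℕ) :
    AnalyticOnNhd ℝ (dividedMonomial x y z i j k) Set.univ :=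
  ((((analyticOnNhd_eval x).pow i).div analyticOnNhd_const
    fun _ _ => Nat.cast_ne_zero.2 i.factorial_ne_zero).mul
    (((analyticOnNhd_eval y).pow j).div analyticOnNhd_const
    fun _ _ => Nat.cast_ne_zero.2 j.factorial_ne_zero)).mul ((analyticOnNhd_eval z).pow k)

theorem fderiv_dividedMonomial_apply (x y z : Fin n) (i j k : ℕ) (p v : Fin n → ℝ) :
    fderiv ℝ (dividedMonomial x y z i j k) p v =
      (i * p x ^ (i - 1) / i ! * v x) * (p y ^ j / j !) * p z ^ k +
      (p x ^ i / i !) * (j * p y ^ (j - 1) / j ! * v y) * p z ^ k +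
      (p x ^ i / i !) * (p y ^ j / j !) * (k * p z ^ (k - 1) * v z) := by
  have h (a : Fin n) : HasFDerivAt (fun p : Fin n → ℝ => p a)
      (ContinuousLinearMap.proj a : (Fin n → ℝ) →L[ℝ] ℝ) p :=
    (ContinuousLinearMap.proj a : (Fin n → ℝ) →L[ℝ] ℝ).hasFDerivAt
  have H := ((((h x).pow i).mul_const ((i ! : ℝ)⁻¹)).mul
    (((h y).pow j).mul_const ((j ! : ℝ)⁻¹))).mul ((h z).pow k)
  have e : dividedMonomial x y z i j k =
      ((fun p : Fin n → ℝ => p x ^ i * (i ! : ℝ)⁻¹) * fun p => p y ^ j * (j ! : ℝ)⁻¹) *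
        fun p => p z ^ k := by
    funext p
    simp [dividedMonomial, div_eq_mul_inv]
  rw [e]
  erw [H.fderiv]
  simp [div_eq_mul_inv]
  ring

theorem natCast_mul_div_factorial_succ (i : ℕ) (t : ℝ) :
    ((i + 1 : ℕ) : ℝ) * t / (i + 1)! = t / i ! := by
  rw [Nat.factorial_succ, Nat.cast_mul, mul_div_mul_left _ _ (Nat.cast_ne_zero.2 i.succ_ne_zero)]

/-- The vector field `x₀ⁱ / i! * x₁ʲ / j! * x₂ᵏ ∂/∂x₃`. -/
noncomputable def monomialField (x y z w : Fin n) (i j k : ℕ) : AnalyticVectorField n :=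
  funField w (dividedMonomial x y z i j k) (analyticOnNhd_dividedMonomial x y z i j k)

variable {x y z w : Fin n}

theorem partialField_lie_monomialField_succ_left (hxy : x ≠ y) (hxz : x ≠ z) (i j k : ℕ) :
    ⁅partialField x, monomialField x y z w (i + 1) j k⁆ = monomialField x y z w i j k := by
  refine partialField_lie_funField _ _ _ _ fun p => ?_
  rw [fderiv_dividedMonomial_apply, Pi.single_eq_same, Pi.single_eq_of_ne hxy.symm,
    Pi.single_eq_of_ne hxz.symm, Nat.add_sub_cancel, natCast_mul_div_factorial_succ,
    dividedMonomial]
  ring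

theorem partialField_lie_monomialField_zero_left (hxy : x ≠ y) (hxz : x ≠ z) (j k : ℕ) :
    ⁅partialField x, monomialField x y z w 0 j k⁆ = 0 := by
  have h : (0 : AnalyticVectorField n) = funField w (fun _ => 0) analyticOnNhd_const := by
    ext1
    funext p
    simp [funField]
  rw [h]
  refine partialField_lie_funField _ _ _ _ fun p => ?_
  simp [fderiv_dividedMonomial_apply, Pi.single_eq_of_ne hxy.symm, Pi.single_eq_of_ne hxz.symm]

theorem monomialField_swap (i j k : ℕ) :
    monomialField x y z w i j k = monomialField y x z w j i k := by
  ext1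
  funext p
  simp only [monomialField, funField, dividedMonomial]
  rw [mul_comm (p x ^ i / i !)]

/-- All these fields point along `∂/∂w`, and no coefficient depends on the variable `w`. -/
theorem monomialField_lie_monomialField (hxw : x ≠ w) (hyw : y ≠ w) (hzw : z ≠ w)
    (i j k i' j' k' : ℕ) :
    ⁅monomialField x y z w i j k, monomialField x y z w i' j' k'⁆ = 0 := by
  refine funField_lie_funField _ _ _ (fun p => ?_) (fun p => ?_) <;>
  simp [fderiv_dividedMonomial_apply, Pi.single_eq_of_ne hxw, Pi.single_eq_of_ne hyw,
    Pi.single_eq_of_ne hzw]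

/-- Over an infinite field a polynomial is determined by its values, so independence is inherited
from the monomial basis of `MvPolynomial`; the factorials only rescale by units. -/
theorem linearIndependent_dividedMonomial (hxy : x ≠ y) (hxz : x ≠ z) (hyz : y ≠ z) :
    LinearIndependent ℝ
      (fun t : ℕ × ℕ × ℕ => dividedMonomial x y z t.1 t.2.1 t.2.2) := by
  let ev : MvPolynomial (Fin n) ℝ →ₗ[ℝ] (Fin n → ℝ) → ℝ :=
    { toFun := fun P p => MvPolynomial.eval p P
      map_add' := fun _ _ => by ext; simp
      map_smul' := fun _ _ => by ext; simp }
  have hev : LinearMap.ker ev = ⊥ :=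
    LinearMap.ker_eq_bot.2 fun P Q h => MvPolynomial.funext fun p => congrFun h p
  let deg (t : ℕ × ℕ × ℕ) : Fin n →₀ ℕ :=
    Finsupp.single x t.1 + Finsupp.single y t.2.1 + Finsupp.single z t.2.2
  have hdeg : Function.Injective deg := by
    rintro ⟨i, j, k⟩ ⟨i', j', k'⟩ h
    have h1 := DFunLike.congr_fun h x
    have h2 := DFunLike.congr_fun h y
    have h3 := DFunLike.congr_fun h z
    simp [deg, hxy, hxz, hyz, hxy.symm, hxz.symm, hyz.symm] at h1 h2 h3
    simp [h1, h2, h3]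
  have H := ((MvPolynomial.basisMonomials (Fin n) ℝ).linearIndependent.comp deg hdeg).map' ev hev
  let wt (t : ℕ × ℕ × ℕ) : ℝˣ := Units.mk0 ((t.1 ! : ℝ)⁻¹ * (t.2.1 ! : ℝ)⁻¹) (by positivity)
  have hfun : (fun t : ℕ × ℕ × ℕ => dividedMonomial x y z t.1 t.2.1 t.2.2) =
      wt • (ev ∘ MvPolynomial.basisMonomials (Fin n) ℝ ∘ deg) := by
    funext t p
    have h1 : (wt t : ℝ) = (t.1 ! : ℝ)⁻¹ * (t.2.1 ! : ℝ)⁻¹ := rfl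
    simp only [Pi.smul_apply', Pi.smul_apply, Function.comp_apply, Units.smul_def, smul_eq_mul, h1,
      dividedMonomial, MvPolynomial.coe_basisMonomials]
    change _ = _ * MvPolynomial.eval p (MvPolynomial.monomial (deg t) 1)
    simp only [deg, MvPolynomial.eval_monomial, one_mul]
    rw [Finsupp.prod_add_index' (by simp) (by intros; ring),
      Finsupp.prod_add_index' (by simp) (by intros; ring)]
    simp only [Finsupp.prod_single_index, pow_zero, div_eq_mul_inv]
    ring
  rw [hfun]
  exact H.units_smul wt

theorem linearIndependent_monomialField (hxy : x ≠ y) (hxz : x ≠ z) (hyz : y ≠ z) :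
    LinearIndependent ℝ
      (fun t : ℕ × ℕ × ℕ => monomialField x y z w t.1 t.2.1 t.2.2) := by
  let comp : AnalyticVectorField n →ₗ[ℝ] (Fin n → ℝ) → ℝ :=
    { toFun := fun X p => X.1 p w
      map_add' := fun _ _ => rfl
      map_smul' := fun _ _ => rfl }
  refine LinearIndependent.of_comp comp ?_
  convert linearIndependent_dividedMonomial hxy hxz hyz using 1
  funext t p
  simp [comp, monomialField, funField]

/-- The `x` and `y` components at the origin separate the two families: they vanish on every
monomial field and determine a combination of `∂/∂x` and `∂/∂y`. -/
theorem linearIndependent_partialField_monomialField (hxy : x ≠ y) (hxz : x ≠ z) (hyz : y ≠ z)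
    (hxw : x ≠ w) (hyw : y ≠ w) :
    LinearIndependent ℝ (Sum.elim ![partialField x, partialField y]
      (fun t : ℕ × ℕ × ℕ => monomialField x y z w t.1 t.2.1 t.2.2)) := by
  have hval (a b : ℝ) : ((a • partialField x + b • partialField y : AnalyticVectorField n) :
      (Fin n → ℝ) → (Fin n → ℝ)) = fun _ => Pi.single x a + Pi.single y b := by
    funext p
    ext c
    simp [partialField, Pi.single_apply]
  refine LinearIndependent.sum_type ?_ (linearIndependent_monomialField hxy hxz hyz) ?_
  · rw [LinearIndependent.pair_iff]
    intro a b h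
    have h' := congrFun (congrArg Subtype.val h) 0
    rw [hval] at h'
    constructor
    · simpa [hxy] using congrFun h' x
    · simpa [hxy.symm] using congrFun h' y
  · rw [Submodule.disjoint_def]
    intro X hX hX'
    have hspan : ∀ X ∈ Submodule.span ℝ (Set.range
        (fun t : ℕ × ℕ × ℕ => monomialField x y z w t.1 t.2.1 t.2.2)),
        X.1 0 x = 0 ∧ X.1 0 y = 0 := by
      intro X hX
      induction hX using Submodule.span_induction with
      | mem X h =>
        obtain ⟨t, rfl⟩ := h
        simp [monomialField, funField, hxw, hyw]
      | zero => simp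
      | add X Y _ _ hX hY => simp [hX, hY]
      | smul a X _ hX => simp [hX]
    obtain ⟨h1, h2⟩ := hspan X hX'
    rw [Matrix.range_cons, Matrix.range_cons, Matrix.range_empty, Set.union_empty,
      Set.singleton_union, Submodule.mem_span_pair] at hX
    obtain ⟨a, b, rfl⟩ := hX
    rw [hval] at h1 h2
    have ha : a = 0 := by simpa [hxy] using h1
    have hb : b = 0 := by simpa [hxy.symm] using h2
    simp [ha, hb]

end AnalyticVectorField

/-! ### The algebra of power series with two derivations. -/

/-- The Lie algebra of the triples `(a, b, u)`, where `u` is a formal power series in `x` and `y`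
with coefficients in `V`; it is the semidirect product of the abelian Lie algebra spanned by
`∂/∂x` and `∂/∂y` and the abelian ideal of power series.  The entry `u i j` is the coefficient of
`xⁱ / i! * yʲ / j!`. -/
@[ext]
structure ShiftAlgebra (F V : Type*) where
  dx : F
  dy : F
  series : ℕ → ℕ → V

namespace ShiftAlgebra

variable {F V : Type*} [Field F] [AddCommGroup V]

/-- The underlying triple. -/
def toProd : ShiftAlgebra F V ≃ F × F × (ℕ → ℕ → V) where
  toFun X := (X.dx, X.dy, X.series)
  invFun t := ⟨t.1, t.2.1, t.2.2⟩

instance : AddCommGroup (ShiftAlgebra F V) := toProd.addCommGroup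

@[simp] theorem zero_dx : (0 : ShiftAlgebra F V).dx = 0 := rfl
@[simp] theorem zero_dy : (0 : ShiftAlgebra F V).dy = 0 := rfl
@[simp] theorem zero_series : (0 : ShiftAlgebra F V).series = 0 := rfl
@[simp] theorem add_dx (X Y : ShiftAlgebra F V) : (X + Y).dx = X.dx + Y.dx := rfl
@[simp] theorem add_dy (X Y : ShiftAlgebra F V) : (X + Y).dy = X.dy + Y.dy := rfl
@[simp] theorem add_series (X Y : ShiftAlgebra F V) :
    (X + Y).series = X.series + Y.series := rfl
/-- The monomial `v xⁱ / i! * yʲ / j!`. -/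
def monomial (i j : ℕ) (v : V) : ShiftAlgebra F V :=
  ⟨0, 0, fun i' j' => if i' = i ∧ j' = j then v else 0⟩

@[simp] theorem monomial_dx (i j : ℕ) (v : V) : (monomial i j v : ShiftAlgebra F V).dx = 0 := rfl
@[simp] theorem monomial_dy (i j : ℕ) (v : V) : (monomial i j v : ShiftAlgebra F V).dy = 0 := rfl
theorem monomial_series (i j : ℕ) (v : V) (i' j' : ℕ) :
    (monomial i j v : ShiftAlgebra F V).series i' j' = if i' = i ∧ j' = j then v else 0 := rfl

theorem monomial_add (i j : ℕ) (v w : V) :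
    (monomial i j (v + w) : ShiftAlgebra F V) = monomial i j v + monomial i j w := by
  ext i' j'
  · simp
  · simp
  · simp only [monomial_series, add_series, Pi.add_apply]
    split_ifs <;> simp

variable [Module F V]

instance : Module F (ShiftAlgebra F V) := toProd.module F

@[simp] theorem smul_dx (a : F) (X : ShiftAlgebra F V) : (a • X).dx = a * X.dx := rfl
@[simp] theorem smul_dy (a : F) (X : ShiftAlgebra F V) : (a • X).dy = a * X.dy := rfl
@[simp] theorem smul_series (a : F) (X : ShiftAlgebra F V) :
    (a • X).series = a • X.series := rfl

/-- The operator `a ∂/∂x + b ∂/∂y` on power series. -/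
def dirDeriv (a b : F) (u : ℕ → ℕ → V) : ℕ → ℕ → V :=
  fun i j => a • u (i + 1) j + b • u i (j + 1)

instance : Bracket (ShiftAlgebra F V) (ShiftAlgebra F V) where
  bracket X Y := ⟨0, 0, dirDeriv X.dx X.dy Y.series - dirDeriv Y.dx Y.dy X.series⟩

@[simp] theorem lie_dx (X Y : ShiftAlgebra F V) : ⁅X, Y⁆.dx = 0 := rfl
@[simp] theorem lie_dy (X Y : ShiftAlgebra F V) : ⁅X, Y⁆.dy = 0 := rfl
theorem lie_series (X Y : ShiftAlgebra F V) :
    ⁅X, Y⁆.series = dirDeriv X.dx X.dy Y.series - dirDeriv Y.dx Y.dy X.series := rfl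

instance : LieRing (ShiftAlgebra F V) where
  add_lie X Y Z := by
    ext i j
    · simp
    · simp
    · simp only [lie_series, dirDeriv, add_series, add_dx, add_dy, Pi.add_apply, Pi.sub_apply]
      module
  lie_add X Y Z := by
    ext i j
    · simp
    · simp
    · simp only [lie_series, dirDeriv, add_series, add_dx, add_dy, Pi.add_apply, Pi.sub_apply]
      module
  lie_self X := by
    ext i j
    · simp
    · simp
    · simp [lie_series]
  leibniz_lie X Y Z := by
    ext i j
    · simp
    · simp
    · simp only [lie_series, dirDeriv, add_series, lie_dx, lie_dy, Pi.add_apply, Pi.sub_apply]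
      module

instance : LieAlgebra F (ShiftAlgebra F V) where
  lie_smul a X Y := by
    ext i j
    · simp
    · simp
    · simp only [lie_series, dirDeriv, smul_series, smul_dx, smul_dy, Pi.smul_apply, Pi.sub_apply]
      module

theorem monomial_smul (i j : ℕ) (a : F) (v : V) :
    (monomial i j (a • v) : ShiftAlgebra F V) = a • monomial i j v := by
  ext i' j'
  · simp
  · simp
  · simp only [monomial_series, smul_series, Pi.smul_apply]
    split_ifs <;> simp

/-- A linear map acts on the coefficients of power series. -/
def mapCoeff {W : Type*} [AddCommGroup W] [Module F W] (f : V →ₗ[F] W) (X : ShiftAlgebra F V) :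
    ShiftAlgebra F W :=
  ⟨X.dx, X.dy, fun i j => f (X.series i j)⟩

section mapCoeff

variable {W : Type*} [AddCommGroup W] [Module F W] (f : V →ₗ[F] W)

@[simp] theorem mapCoeff_dx (X : ShiftAlgebra F V) : (mapCoeff f X).dx = X.dx := rfl
@[simp] theorem mapCoeff_dy (X : ShiftAlgebra F V) : (mapCoeff f X).dy = X.dy := rfl
theorem mapCoeff_series (X : ShiftAlgebra F V) (i j : ℕ) :
    (mapCoeff f X).series i j = f (X.series i j) := rfl

theorem mapCoeff_add (X Y : ShiftAlgebra F V) : mapCoeff f (X + Y) = mapCoeff f X + mapCoeff f Y := by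
  ext i j
  · simp
  · simp
  · simp [mapCoeff_series]

theorem mapCoeff_smul (a : F) (X : ShiftAlgebra F V) : mapCoeff f (a • X) = a • mapCoeff f X := by
  ext i j
  · simp
  · simp
  · simp [mapCoeff_series]

theorem mapCoeff_lie (X Y : ShiftAlgebra F V) : mapCoeff f ⁅X, Y⁆ = ⁅mapCoeff f X, mapCoeff f Y⁆ := by
  ext i j
  · simp
  · simp
  · simp [mapCoeff_series, lie_series, dirDeriv]

theorem mapCoeff_mapCoeff_of_leftInverse {g : W →ₗ[F] V} (h : Function.LeftInverse g f)
    (X : ShiftAlgebra F V) : mapCoeff g (mapCoeff f X) = X := by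
  ext i j
  · simp
  · simp
  · simp [mapCoeff_series, h _]

end mapCoeff

/-- `ShiftAlgebra.monomial` as a linear map. -/
def monomialₗ (i j : ℕ) : V →ₗ[F] ShiftAlgebra F V where
  toFun := monomial i j
  map_add' := monomial_add i j
  map_smul' := monomial_smul i j

/-- Projection to the power series. -/
def seriesₗ : ShiftAlgebra F V →ₗ[F] (ℕ → ℕ → V) where
  toFun := series
  map_add' _ _ := rfl
  map_smul' _ _ := rfl

/-- Projection to the coefficient of `∂/∂x`. -/
def dxₗ : ShiftAlgebra F V →ₗ[F] F where
  toFun := dx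
  map_add' _ _ := rfl
  map_smul' _ _ := rfl

/-- Projection to the coefficient of `∂/∂y`. -/
def dyₗ : ShiftAlgebra F V →ₗ[F] F where
  toFun := dy
  map_add' _ _ := rfl
  map_smul' _ _ := rfl

end ShiftAlgebra

/-! ### The quintuple and the nilpotent Lie algebra of a pair. -/

/-- The five pencils `(1, 0)`, `(0, 1)`, `(1, 1)`, `(1, x)`, `(1, y)`. -/
def pencil (F : Type*) [Field F] (k : Fin 5) : Fin 2 → FreeAlgebra F (Fin 2) :=
  ![![1, 0], ![0, 1], ![1, 1], ![1, FreeAlgebra.ι F 0], ![1, FreeAlgebra.ι F 1]] k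

/-- The five maps `v ↦ (v, 0)`, `(0, v)`, `(v, v)`, `(v, A v)`, `(v, B v)`; their images form a
quintuple of subspaces. -/
def pencilMap {F : Type*} [Field F] {m : ℕ} (A B : Matrix (Fin m) (Fin m) F) (k : Fin 5) :
    (Fin m → F) →ₗ[F] (Fin 2 → Fin m → F) :=
  LinearMap.pi fun ε => (ncEval A B (pencil F k ε)).mulVecLin

/-- The exponents of the divisors of `x⁴ y` and of `y⁵`. -/
def IsHookExponent (i j : ℕ) : Prop := (i ≤ 4 ∧ j ≤ 1) ∨ (i = 0 ∧ j ≤ 5)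

instance (i j : ℕ) : Decidable (IsHookExponent i j) := by
  unfold IsHookExponent
  infer_instance

section Pair

variable {F : Type*} [Field F] {m : ℕ}

/-- The coefficients: two vectors of length `m` and a number. -/
abbrev PairCoeff (F : Type*) (m : ℕ) : Type _ := (Fin 2 → Fin m → F) × F

open ShiftAlgebra

/-- The Lie algebra of a pair of matrices. -/
def pairAlgebra (A B : Matrix (Fin m) (Fin m) F) :
    LieSubalgebra F (ShiftAlgebra F (PairCoeff F m)) where
  -- The vector part has degree at most 4. Its five coefficients of degree exactly 4 carry the
  -- quintuple, and those of lower degree are free. The scalar part lives on the hook.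
  carrier := {X | (∀ i j, 4 < i + j → (X.series i j).1 = 0) ∧
    (∀ k : Fin 5, (X.series k.rev k).1 ∈ LinearMap.range (pencilMap A B k)) ∧
    ∀ i j, ¬ IsHookExponent i j → (X.series i j).2 = 0}
  add_mem' := by
    rintro X Y ⟨h1, h2, h3⟩ ⟨h1', h2', h3'⟩
    refine ⟨fun i j h => ?_, fun k => ?_, fun i j h => ?_⟩
    · simp [h1 i j h, h1' i j h]
    · exact add_mem (h2 k) (h2' k)
    · simp [h3 i j h, h3' i j h]
  zero_mem' := ⟨fun _ _ _ => rfl, fun _ => zero_mem _, fun _ _ _ => rfl⟩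
  smul_mem' := by
    rintro a X ⟨h1, h2, h3⟩
    refine ⟨fun i j h => ?_, fun k => ?_, fun i j h => ?_⟩
    · simp [h1 i j h]
    · exact Submodule.smul_mem _ a (h2 k)
    · simp [h3 i j h]
  lie_mem' := by
    rintro X Y ⟨h1, h2, h3⟩ ⟨h1', h2', h3'⟩
    -- A bracket lowers the degree, so its vector part has degree at most 3 and the pencil
    -- conditions on it become void.
    have key : ∀ i j, 3 < i + j → (⁅X, Y⁆.series i j).1 = 0 := by
      intro i j h
      simp [lie_series, dirDeriv, h1 (i + 1) j (by omega), h1' (i + 1) j (by omega),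
        h1 i (j + 1) (by omega), h1' i (j + 1) (by omega)]
    refine ⟨fun i j h => key i j (by omega), fun k => ?_, fun i j h => ?_⟩
    · rw [key _ _ (by rw [Fin.val_rev]; omega)]
      exact zero_mem _
    -- The hook is closed under divisors, so derivatives keep its complement empty.
    · have ha : ¬ IsHookExponent (i + 1) j := by unfold IsHookExponent at *; omega
      have hb : ¬ IsHookExponent i (j + 1) := by unfold IsHookExponent at *; omega
      simp [lie_series, dirDeriv, h3 _ _ ha, h3' _ _ ha, h3 _ _ hb, h3' _ _ hb]

variable {A B : Matrix (Fin m) (Fin m) F}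

theorem series_eq_zero_of_mem_pairAlgebra {X : ShiftAlgebra F (PairCoeff F m)}
    (hX : X ∈ pairAlgebra A B) {i j : ℕ} (h : 5 < i + j) : X.series i j = 0 :=
  Prod.ext (hX.1 i j (by omega)) (hX.2.2 i j (by unfold IsHookExponent; omega))

theorem mk_zero_series_mem_pairAlgebra (a b : F) :
    (⟨a, b, 0⟩ : ShiftAlgebra F (PairCoeff F m)) ∈ pairAlgebra A B :=
  ⟨fun _ _ _ => rfl, fun _ => zero_mem _, fun _ _ _ => rfl⟩

theorem monomial_snd_mem_pairAlgebra {i j : ℕ} (h : IsHookExponent i j) (t : F) :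
    (monomial i j (0, t) : ShiftAlgebra F (PairCoeff F m)) ∈ pairAlgebra A B := by
  have h1 : ∀ i' j', ((monomial i j (0, t) :
      ShiftAlgebra F (PairCoeff F m)).series i' j').1 = 0 := by
    intro i' j'
    rw [monomial_series]
    split_ifs <;> rfl
  refine ⟨fun i' j' _ => h1 _ _, fun k => ?_, fun i' j' h' => ?_⟩
  · rw [h1]
    exact zero_mem _
  · rw [monomial_series, if_neg]
    · rfl
    · rintro ⟨rfl, rfl⟩
      exact h' h

theorem monomial_snd_eq_zero (i j : ℕ) (w : Fin 2 → Fin m → F) (i' j' : ℕ) :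
    ((monomial i j (w, 0) : ShiftAlgebra F (PairCoeff F m)).series i' j').2 = 0 := by
  rw [monomial_series]
  split_ifs <;> rfl

theorem monomial_fst_mem_pairAlgebra_of_lt {i j : ℕ} (h : i + j < 4) (w : Fin 2 → Fin m → F) :
    (monomial i j (w, 0) : ShiftAlgebra F (PairCoeff F m)) ∈ pairAlgebra A B := by
  have h1 : ∀ i' j', 3 < i' + j' → ((monomial i j (w, 0) :
      ShiftAlgebra F (PairCoeff F m)).series i' j').1 = 0 := by
    intro i' j' _
    rw [monomial_series, if_neg (by omega)]
    rfl
  refine ⟨fun i' j' _ => h1 _ _ (by omega), fun k => ?_, fun i' j' _ =>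
    monomial_snd_eq_zero _ _ _ _ _⟩
  rw [h1 _ _ (by rw [Fin.val_rev]; omega)]
  exact zero_mem _

theorem monomial_fst_mem_pairAlgebra (k : Fin 5) (v : Fin m → F) :
    (monomial k.rev k (pencilMap A B k v, 0) : ShiftAlgebra F (PairCoeff F m)) ∈
      pairAlgebra A B := by
  refine ⟨fun i' j' _ => ?_, fun k' => ?_, fun i' j' _ => monomial_snd_eq_zero _ _ _ _ _⟩
  · rw [monomial_series, if_neg (by rw [Fin.val_rev]; omega)]
    rfl
  · rw [monomial_series]
    split_ifs with h
    · obtain rfl : k' = k := Fin.ext h.2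
      exact ⟨v, rfl⟩
    · exact zero_mem _

instance isNilpotent_pairAlgebra (A B : Matrix (Fin m) (Fin m) F) :
    LieRing.IsNilpotent (pairAlgebra A B) := by
  -- Filtration by degree: `I d` consists of the series of degree at most `5 - d`, read as zero once
  -- `d > 5`.
  let I (d : ℕ) : LieIdeal F (pairAlgebra A B) :=
    { carrier := {X | X.1.dx = 0 ∧ X.1.dy = 0 ∧ ∀ i j, 5 < i + j + d → X.1.series i j = 0}
      add_mem' := by
        rintro X Y ⟨h1, h2, h3⟩ ⟨h1', h2', h3'⟩
        exact ⟨by simp [h1, h1'], by simp [h2, h2'], fun i j h => by simp [h3 i j h, h3' i j h]⟩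
      zero_mem' := ⟨rfl, rfl, fun _ _ _ => rfl⟩
      smul_mem' := by
        rintro a X ⟨h1, h2, h3⟩
        exact ⟨by simp [h1], by simp [h2], fun i j h => by simp [h3 i j h]⟩
      lie_mem := by
        rintro X Y ⟨h1, h2, h3⟩
        refine ⟨by simp, by simp, fun i j h => ?_⟩
        simp [lie_series, dirDeriv, h1, h2, h3 (i + 1) j (by omega), h3 i (j + 1) (by omega)] }
  have hI : ∀ d, LieModule.lowerCentralSeries F (pairAlgebra A B) (pairAlgebra A B) (d + 1) ≤
      I d := by
    intro d
    induction d with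
    | zero =>
      rw [LieModule.lowerCentralSeries_succ, LieSubmodule.lie_le_iff]
      intro X _ Y _
      refine ⟨by simp, by simp, fun i j h => ?_⟩
      exact series_eq_zero_of_mem_pairAlgebra ⁅X, Y⁆.2 h
    | succ d ih =>
      rw [LieModule.lowerCentralSeries_succ, LieSubmodule.lie_le_iff]
      intro X _ Y hY
      obtain ⟨h1, h2, h3⟩ := ih hY
      refine ⟨by simp, by simp, fun i j h => ?_⟩
      simp [lie_series, dirDeriv, h1, h2, h3 (i + 1) j (by omega), h3 i (j + 1) (by omega)]
  rw [LieRing.IsNilpotent, LieModule.isNilpotent_iff F]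
  refine ⟨7, ?_⟩
  rw [eq_bot_iff]
  refine (hI 6).trans ?_
  rintro X ⟨h1, h2, h3⟩
  rw [LieSubmodule.mem_bot]
  ext i j
  · exact h1
  · exact h2
  all_goals simp [h3 i j (by omega)]

end Pair

/-! ### Quintuples determine pairs up to similarity, and similarity induces isomorphism. -/

open ShiftAlgebra

section Similarity

variable {F : Type*} [Field F] {m : ℕ} {A B A' B' : Matrix (Fin m) (Fin m) F}

theorem pencilMap_zero (v : Fin m → F) : pencilMap A B 0 v = ![v, 0] := by
  ext ε i
  fin_cases ε <;> simp [pencilMap, pencil]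

theorem pencilMap_one (v : Fin m → F) : pencilMap A B 1 v = ![0, v] := by
  ext ε i
  fin_cases ε <;> simp [pencilMap, pencil]

theorem pencilMap_two (v : Fin m → F) : pencilMap A B 2 v = ![v, v] := by
  ext ε i
  fin_cases ε <;> simp [pencilMap, pencil]

theorem pencilMap_three (v : Fin m → F) : pencilMap A B 3 v = ![v, A.mulVec v] := by
  ext ε i
  fin_cases ε <;> simp [pencilMap, pencil, ncEval]

theorem pencilMap_four (v : Fin m → F) : pencilMap A B 4 v = ![v, B.mulVec v] := by
  ext ε i
  fin_cases ε <;> simp [pencilMap, pencil, ncEval]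

/-- An intertwiner `P`, acting diagonally as `P ⊕ P`, carries each subspace of one quintuple into
the corresponding subspace of the other. -/
theorem pencilMap_mulVec {P : Matrix (Fin m) (Fin m) F} (hA : P * A = A' * P)
    (hB : P * B = B' * P) (k : Fin 5) (v : Fin m → F) :
    pencilMap A' B' k (P.mulVec v) = fun ε => P.mulVec (pencilMap A B k v ε) := by
  fin_cases k
  · change pencilMap A' B' 0 _ = fun ε => P.mulVec (pencilMap A B 0 v ε)
    rw [pencilMap_zero, pencilMap_zero]
    ext ε
    fin_cases ε <;> simp
  · change pencilMap A' B' 1 _ = fun ε => P.mulVec (pencilMap A B 1 v ε)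
    rw [pencilMap_one, pencilMap_one]
    ext ε
    fin_cases ε <;> simp
  · change pencilMap A' B' 2 _ = fun ε => P.mulVec (pencilMap A B 2 v ε)
    rw [pencilMap_two, pencilMap_two]
    ext ε
    fin_cases ε <;> simp
  · change pencilMap A' B' 3 _ = fun ε => P.mulVec (pencilMap A B 3 v ε)
    rw [pencilMap_three, pencilMap_three]
    ext ε
    fin_cases ε <;> simp [hA]
  · change pencilMap A' B' 4 _ = fun ε => P.mulVec (pencilMap A B 4 v ε)
    rw [pencilMap_four, pencilMap_four]
    ext ε
    fin_cases ε <;> simp [hB]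

/-- An isomorphism between the quintuples of subspaces of two pairs makes the pairs similar. -/
theorem pairSimilar_of_map_range_pencilMap
    (f : (Fin 2 → Fin m → F) →ₗ[F] (Fin 2 → Fin m → F)) (hf : Function.Injective f)
    (h : ∀ k v, f (pencilMap A B k v) ∈ LinearMap.range (pencilMap A' B' k)) :
    PairSimilar A B A' B' := by
  let inl : (Fin m → F) →ₗ[F] (Fin 2 → Fin m → F) := pencilMap A B 0
  let P : (Fin m → F) →ₗ[F] (Fin m → F) := LinearMap.proj 0 ∘ₗ f ∘ₗ inl
  have h0 : ∀ v, f ![v, 0] = ![P v, 0] := by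
    intro v
    obtain ⟨x, hx⟩ := h 0 v
    have hP : P v = f (pencilMap A B 0 v) 0 := rfl
    rw [hP, ← hx, ← pencilMap_zero (A := A) (B := B), ← hx, pencilMap_zero]
    rfl
  -- The second subspace gives `f (0, v) = (0, x)`. Then `f (v, v) = (P v, x)` must lie on the
  -- diagonal, whence `x = P v`.
  have h1 : ∀ v, f ![0, v] = ![0, P v] := by
    intro v
    obtain ⟨x, hx⟩ := h 1 v
    obtain ⟨y, hy⟩ := h 2 v
    rw [pencilMap_one, pencilMap_one] at hx
    have e : (![v, v] : Fin 2 → Fin m → F) = ![v, 0] + ![0, v] := by simp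
    rw [pencilMap_two, pencilMap_two, e, map_add, h0, ← hx] at hy
    have hy0 := congrFun hy 0
    have hy1 := congrFun hy 1
    simp at hy0 hy1
    rw [← hx, ← hy1, hy0]
  have hP : ∀ v w, f ![v, w] = ![P v, P w] := by
    intro v w
    have e : (![v, w] : Fin 2 → Fin m → F) = ![v, 0] + ![0, w] := by simp
    rw [e, map_add, h0, h1]
    simp
  -- The vector `f (v, Av) = (P v, P (Av))` lies in the graph of `A'`.
  have hA : ∀ v, P (A.mulVec v) = A'.mulVec (P v) := by
    intro v
    obtain ⟨x, hx⟩ := h 3 v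
    rw [pencilMap_three, pencilMap_three, hP] at hx
    have h0 := congrFun hx 0
    have h1 := congrFun hx 1
    simp at h0 h1
    rw [← h1, h0]
  have hB : ∀ v, P (B.mulVec v) = B'.mulVec (P v) := by
    intro v
    obtain ⟨x, hx⟩ := h 4 v
    rw [pencilMap_four, pencilMap_four, hP] at hx
    have h0 := congrFun hx 0
    have h1 := congrFun hx 1
    simp at h0 h1
    rw [← h1, h0]
  let p := LinearMap.toMatrix' P
  have hp : ∀ v, p.mulVec v = P v := fun v => LinearMap.toMatrix'_mulVec P v
  have hinj : Function.Injective p.mulVec := by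
    intro v w hvw
    rw [hp, hp] at hvw
    have := hf ((h0 v).trans ((congrArg (fun t => ![t, 0]) hvw).trans (h0 w).symm))
    exact congrFun this 0
  have hunit : IsUnit p.det :=
    (Matrix.isUnit_iff_isUnit_det p).1 (Matrix.mulVec_injective_iff_isUnit.1 hinj)
  have key : ∀ {C C' : Matrix (Fin m) (Fin m) F},
      (∀ v, P (C.mulVec v) = C'.mulVec (P v)) → C' = p⁻¹⁻¹ * C * p⁻¹ := by
    intro C C' hC
    have e : p * C = C' * p := by
      refine Matrix.ext_of_mulVec_single fun i => ?_
      rw [← Matrix.mulVec_mulVec, ← Matrix.mulVec_mulVec, hp, hp, hC]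
    rw [Matrix.nonsing_inv_nonsing_inv _ hunit, e, Matrix.mul_nonsing_inv_cancel_right _ _ hunit]
  -- The intertwiner gives `A' = p A p⁻¹`, so the conjugating matrix in the convention `S⁻¹ A S` is
  -- `p⁻¹`.
  exact ⟨p⁻¹, (Matrix.isUnit_nonsing_inv_det_iff).2 hunit, key hA, key hB⟩

/-- The action of a matrix on the coefficients. -/
def coeffMap (P : Matrix (Fin m) (Fin m) F) : PairCoeff F m →ₗ[F] PairCoeff F m where
  toFun v := (fun ε => P.mulVec (v.1 ε), v.2)
  map_add' v w := by
    refine Prod.ext (funext fun ε => ?_) rfl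
    simp [Matrix.mulVec_add]
  map_smul' a v := by
    refine Prod.ext (funext fun ε => ?_) rfl
    simp [Matrix.mulVec_smul]

theorem coeffMap_apply (P : Matrix (Fin m) (Fin m) F) (v : PairCoeff F m) :
    coeffMap P v = (fun ε => P.mulVec (v.1 ε), v.2) := rfl

theorem shiftAlgebraMap_coeffMap_mem {P : Matrix (Fin m) (Fin m) F} (hA : P * A = A' * P)
    (hB : P * B = B' * P) {X : ShiftAlgebra F (PairCoeff F m)} (hX : X ∈ pairAlgebra A B) :
    ShiftAlgebra.mapCoeff (coeffMap P) X ∈ pairAlgebra A' B' := by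
  obtain ⟨h1, h2, h3⟩ := hX
  refine ⟨fun i j h => ?_, fun k => ?_, fun i j h => ?_⟩
  · rw [ShiftAlgebra.mapCoeff_series, coeffMap_apply, h1 i j h]
    ext ε : 1
    simp
  · obtain ⟨v, hv⟩ := h2 k
    exact ⟨P.mulVec v, by
      rw [pencilMap_mulVec hA hB, hv, ShiftAlgebra.mapCoeff_series, coeffMap_apply]⟩
  · rw [ShiftAlgebra.mapCoeff_series, coeffMap_apply]
    exact h3 i j h

/-- An intertwining matrix acts on the Lie algebras. -/
def pairAlgebraMap (P : Matrix (Fin m) (Fin m) F) (hA : P * A = A' * P) (hB : P * B = B' * P) :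
    pairAlgebra A B →ₗ⁅F⁆ pairAlgebra A' B' where
  toFun X := ⟨ShiftAlgebra.mapCoeff (coeffMap P) X.1, shiftAlgebraMap_coeffMap_mem hA hB X.2⟩
  map_add' X Y := Subtype.ext (ShiftAlgebra.mapCoeff_add _ X.1 Y.1)
  map_smul' a X := Subtype.ext (ShiftAlgebra.mapCoeff_smul _ a X.1)
  map_lie' {X Y} := Subtype.ext (ShiftAlgebra.mapCoeff_lie _ X.1 Y.1)

theorem pairAlgebraMap_pairAlgebraMap (P Q : Matrix (Fin m) (Fin m) F) (hA : P * A = A' * P)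
    (hB : P * B = B' * P) (hA' : Q * A' = A * Q) (hB' : Q * B' = B * Q) (hQP : Q * P = 1)
    (X : pairAlgebra A B) : pairAlgebraMap Q hA' hB' (pairAlgebraMap P hA hB X) = X := by
  apply Subtype.ext
  change ShiftAlgebra.mapCoeff (coeffMap Q) (ShiftAlgebra.mapCoeff (coeffMap P) X.1) = X.1
  apply ShiftAlgebra.mapCoeff_mapCoeff_of_leftInverse
  intro v
  simp [coeffMap_apply, hQP]

/-- Both `S⁻¹` and `S` intertwine the pairs, in opposite directions; their actions on the
coefficients are mutually inverse Lie homomorphisms. -/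
theorem PairSimilar.nonempty_equiv_pairAlgebra (h : PairSimilar A B A' B') :
    Nonempty (pairAlgebra A B ≃ₗ⁅F⁆ pairAlgebra A' B') := by
  obtain ⟨S, hS, hA, hB⟩ := h
  have key {C C' : Matrix (Fin m) (Fin m) F} (h : C' = S⁻¹ * C * S) : S⁻¹ * C = C' * S⁻¹ := by
    rw [h, Matrix.mul_nonsing_inv_cancel_right _ _ hS]
  have key' {C C' : Matrix (Fin m) (Fin m) F} (h : C' = S⁻¹ * C * S) : S * C' = C * S := by
    rw [h, Matrix.mul_assoc, Matrix.mul_nonsing_inv_cancel_left _ _ hS]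
  exact ⟨LieEquiv.mk (pairAlgebraMap S⁻¹ (key hA) (key hB))
    (pairAlgebraMap S (key' hA) (key' hB))
    (pairAlgebraMap_pairAlgebraMap _ _ _ _ _ _ (Matrix.mul_nonsing_inv _ hS))
    (pairAlgebraMap_pairAlgebraMap _ _ _ _ _ _ (Matrix.nonsing_inv_mul _ hS))⟩

end Similarity

/-! ### Recovering the quintuple from the abstract Lie algebra. -/

section Isomorphism

variable {F : Type*} [Field F] {m : ℕ} {A B A' B' : Matrix (Fin m) (Fin m) F}

theorem lie_series_of_dx_dy_eq_zero (X : pairAlgebra A B) {Y : pairAlgebra A B}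
    (h1 : Y.1.dx = 0) (h2 : Y.1.dy = 0) (i j : ℕ) :
    ⁅X, Y⁆.1.series i j =
      X.1.dx • Y.1.series (i + 1) j + X.1.dy • Y.1.series i (j + 1) := by
  rw [LieSubalgebra.coe_bracket, lie_series, Pi.sub_apply, Pi.sub_apply, h1, h2]
  simp [dirDeriv]

/-- The element `∂/∂x` of the Lie algebra of a pair. -/
def pairAlgebraDx (A B : Matrix (Fin m) (Fin m) F) : pairAlgebra A B :=
  ⟨⟨1, 0, 0⟩, mk_zero_series_mem_pairAlgebra 1 0⟩

/-- The element `∂/∂y` of the Lie algebra of a pair. -/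
def pairAlgebraDy (A B : Matrix (Fin m) (Fin m) F) : pairAlgebra A B :=
  ⟨⟨0, 1, 0⟩, mk_zero_series_mem_pairAlgebra 0 1⟩

/-- The monomial `xⁱ / i! * yʲ / j!` with coefficient in the distinguished line. -/
def pairAlgebraHook (A B : Matrix (Fin m) (Fin m) F) (i j : ℕ) (h : IsHookExponent i j) :
    pairAlgebra A B :=
  ⟨monomial i j (0, 1), monomial_snd_mem_pairAlgebra h 1⟩

theorem pairAlgebraDx_lie_series {Y : pairAlgebra A B} (h1 : Y.1.dx = 0) (h2 : Y.1.dy = 0)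
    (i j : ℕ) : ⁅pairAlgebraDx A B, Y⁆.1.series i j = Y.1.series (i + 1) j := by
  rw [lie_series_of_dx_dy_eq_zero _ h1 h2]
  simp [pairAlgebraDx]

theorem pairAlgebraDy_lie_series {Y : pairAlgebra A B} (h1 : Y.1.dx = 0) (h2 : Y.1.dy = 0)
    (i j : ℕ) : ⁅pairAlgebraDy A B, Y⁆.1.series i j = Y.1.series i (j + 1) := by
  rw [lie_series_of_dx_dy_eq_zero _ h1 h2]
  simp [pairAlgebraDy]

theorem pairAlgebra_lie_dx (X Y : pairAlgebra A B) : ⁅X, Y⁆.1.dx = 0 := rfl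

theorem pairAlgebra_lie_dy (X Y : pairAlgebra A B) : ⁅X, Y⁆.1.dy = 0 := rfl

/-- The series form the centralizer of the derived algebra. -/
theorem dx_dy_eq_zero_iff (X : pairAlgebra A B) :
    (X.1.dx = 0 ∧ X.1.dy = 0) ↔ ∀ Y Z : pairAlgebra A B, ⁅X, ⁅Y, Z⁆⁆ = 0 := by
  constructor
  · rintro ⟨h1, h2⟩ Y Z
    refine Subtype.ext (ShiftAlgebra.ext rfl rfl ?_)
    funext i j
    rw [lie_series_of_dx_dy_eq_zero _ (pairAlgebra_lie_dx _ _) (pairAlgebra_lie_dy _ _), h1, h2]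
    simp
  · intro h
    constructor
    -- The bracket `[∂/∂x, x²/2]` is `x`, on which `X` acts with constant coefficient `X.dx`.
    · have h := h (pairAlgebraDx A B) (pairAlgebraHook A B 2 0 (by decide))
      have h' := congrArg (fun X => (X.1.series 0 0).2) h
      change (_ : PairCoeff F m).2 = 0 at h'
      rw [lie_series_of_dx_dy_eq_zero _ (pairAlgebra_lie_dx _ _) (pairAlgebra_lie_dy _ _),
        pairAlgebraDx_lie_series rfl rfl, pairAlgebraDx_lie_series rfl rfl] at h'
      simpa [pairAlgebraHook, monomial_series] using h'
    · have h := h (pairAlgebraDy A B) (pairAlgebraHook A B 0 2 (by decide))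
      have h' := congrArg (fun X => (X.1.series 0 0).2) h
      change (_ : PairCoeff F m).2 = 0 at h'
      rw [lie_series_of_dx_dy_eq_zero _ (pairAlgebra_lie_dx _ _) (pairAlgebra_lie_dy _ _),
        pairAlgebraDy_lie_series rfl rfl, pairAlgebraDy_lie_series rfl rfl] at h'
      simpa [pairAlgebraHook, monomial_series] using h'

/-- Being a centralizer of the derived algebra is intrinsic, so isomorphisms preserve the ideal of
series. -/
theorem map_dx_dy_eq_zero_iff (φ : pairAlgebra A B ≃ₗ⁅F⁆ pairAlgebra A' B')
    (X : pairAlgebra A B) :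
    ((φ X).1.dx = 0 ∧ (φ X).1.dy = 0) ↔ (X.1.dx = 0 ∧ X.1.dy = 0) := by
  rw [dx_dy_eq_zero_iff, dx_dy_eq_zero_iff]
  constructor
  · intro h Y Z
    apply EquivLike.injective φ
    rw [LieEquiv.map_lie, LieEquiv.map_lie, h, map_zero]
  · intro h Y Z
    have h := congrArg φ (h (φ.symm Y) (φ.symm Z))
    simpa only [LieEquiv.map_lie, LieEquiv.apply_symm_apply, map_zero] using h

/-- An isomorphism preserves the line of `∂/∂x` modulo series. -/
theorem map_pairAlgebraDx_dy (φ : pairAlgebra A B ≃ₗ⁅F⁆ pairAlgebra A' B') :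
    (φ (pairAlgebraDx A B)).1.dy = 0 := by
  set D := pairAlgebraDx A B
  set y := pairAlgebraHook A' B' 0 5 (by decide) with hy
  have hz : (φ.symm y).1.dx = 0 ∧ (φ.symm y).1.dy = 0 :=
    (map_dx_dy_eq_zero_iff φ.symm y).2 ⟨rfl, rfl⟩
  -- No monomial divisible by `x⁵` occurs in the algebra. Transported by `φ`, this says that the
  -- fifth power of `φ D` kills `y⁵/5!`, and the constant coefficient obtained is the fifth power of
  -- the `∂/∂y` coefficient of `φ D`.
  have h : ⁅D, ⁅D, ⁅D, ⁅D, ⁅D, φ.symm y⁆⁆⁆⁆⁆ = 0 := by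
    refine Subtype.ext (ShiftAlgebra.ext rfl rfl ?_)
    funext i j
    iterate 4 rw [pairAlgebraDx_lie_series (pairAlgebra_lie_dx _ _) (pairAlgebra_lie_dy _ _)]
    rw [pairAlgebraDx_lie_series hz.1 hz.2]
    exact Prod.ext ((φ.symm y).2.1 _ _ (by omega))
      ((φ.symm y).2.2.2 _ _ (by unfold IsHookExponent; omega))
  have h' := congrArg (fun X => ((φ X).1.series 0 0).2) h
  simp only [LieEquiv.map_lie, LieEquiv.apply_symm_apply, map_zero] at h'
  simpa [lie_series, dirDeriv, hy,
    pairAlgebraHook, monomial_series] using h'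

theorem map_pairAlgebraDx_dx_ne_zero (φ : pairAlgebra A B ≃ₗ⁅F⁆ pairAlgebra A' B') :
    (φ (pairAlgebraDx A B)).1.dx ≠ 0 := fun h =>
  one_ne_zero ((map_dx_dy_eq_zero_iff φ _).1 ⟨h, map_pairAlgebraDx_dy φ⟩).1

/-- On the two-dimensional quotient by series the isomorphism is triangular. A zero second diagonal
entry would make a combination of `∂/∂x` and `∂/∂y` with nonzero `∂/∂y` coefficient map into series.
-/
theorem map_pairAlgebraDy_dy_ne_zero (φ : pairAlgebra A B ≃ₗ⁅F⁆ pairAlgebra A' B') :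
    (φ (pairAlgebraDy A B)).1.dy ≠ 0 := by
  intro h
  set a := (φ (pairAlgebraDx A B)).1.dx
  set c := (φ (pairAlgebraDy A B)).1.dx
  refine map_pairAlgebraDx_dx_ne_zero φ ?_
  have h' := (map_dx_dy_eq_zero_iff φ (a • pairAlgebraDy A B - c • pairAlgebraDx A B)).1 (by
    rw [map_sub, map_smul, map_smul]
    change a * c - c * a = 0 ∧ a * (φ (pairAlgebraDy A B)).1.dy -
      c * (φ (pairAlgebraDx A B)).1.dy = 0
    rw [h, map_pairAlgebraDx_dy]
    constructor <;> ring)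
  have h2 : a * 1 - c * 0 = 0 := h'.2
  simpa using h2

/-- An isomorphism preserves the line of `∂/∂y` modulo series. -/
theorem map_pairAlgebraDy_dx [CharZero F] (φ : pairAlgebra A B ≃ₗ⁅F⁆ pairAlgebra A' B') :
    (φ (pairAlgebraDy A B)).1.dx = 0 := by
  set D := pairAlgebraDx A B with hD
  set E := pairAlgebraDy A B with hE
  set y := pairAlgebraHook A' B' 4 1 (by decide) with hy
  have hz : (φ.symm y).1.dx = 0 ∧ (φ.symm y).1.dy = 0 :=
    (map_dx_dy_eq_zero_iff φ.symm y).2 ⟨rfl, rfl⟩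
  -- No monomial divisible by `x³y²` occurs in the algebra.
  have h : ⁅D, ⁅D, ⁅D, ⁅E, ⁅E, φ.symm y⁆⁆⁆⁆⁆ = 0 := by
    refine Subtype.ext (ShiftAlgebra.ext rfl rfl ?_)
    funext i j
    iterate 3 rw [pairAlgebraDx_lie_series (pairAlgebra_lie_dx _ _) (pairAlgebra_lie_dy _ _)]
    rw [pairAlgebraDy_lie_series (pairAlgebra_lie_dx _ _) (pairAlgebra_lie_dy _ _),
      pairAlgebraDy_lie_series hz.1 hz.2]
    exact Prod.ext ((φ.symm y).2.1 _ _ (by omega))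
      ((φ.symm y).2.2.2 _ _ (by unfold IsHookExponent; omega))
  have h' := congrArg (fun X => ((φ X).1.series 0 0).2) h
  simp only [LieEquiv.map_lie, LieEquiv.apply_symm_apply, map_zero] at h'
  have ha : (φ D).1.dx ≠ 0 := map_pairAlgebraDx_dx_ne_zero φ
  have hb : (φ D).1.dy = 0 := map_pairAlgebraDx_dy φ
  have hd : (φ E).1.dy ≠ 0 := map_pairAlgebraDy_dy_ne_zero φ
  simp [lie_series, dirDeriv, hy,
    pairAlgebraHook, monomial_series, hb, ha] at h'
  -- With `φ D = a ∂/∂x` and `φ E = c ∂/∂x + d ∂/∂y` modulo series, the operator `a³ ∂ₓ³ (c ∂ₓ + d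
  -- ∂ᵧ)²` sends `x⁴y/4!` to `2 a³ c d`. Characteristic zero removes the factor 2.
  have h2 : 2 * ((φ E).1.dx * (φ E).1.dy) = 0 := by linear_combination h'
  simpa [hd] using h2

/-- On series, an isomorphism intertwines the derivations up to nonzero factors. -/
theorem exists_map_series_eq [CharZero F] (φ : pairAlgebra A B ≃ₗ⁅F⁆ pairAlgebra A' B') :
    ∃ a d : F, a ≠ 0 ∧ d ≠ 0 ∧ ∀ (p q : ℕ) (X Y : pairAlgebra A B),
      X.1.dx = 0 → X.1.dy = 0 → Y.1.dx = 0 → Y.1.dy = 0 →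
      (∀ i j, Y.1.series i j = X.1.series (i + p) (j + q)) →
      ∀ i j, (φ Y).1.series i j = (a ^ p * d ^ q) • (φ X).1.series (i + p) (j + q) := by
  refine ⟨_, _, map_pairAlgebraDx_dx_ne_zero φ, map_pairAlgebraDy_dy_ne_zero φ, fun p => ?_⟩
  induction p with
  | zero =>
    intro q
    induction q with
    | zero =>
      intro X Y h1 h2 h3 h4 h i j
      have : Y = X := Subtype.ext (ShiftAlgebra.ext (h3.trans h1.symm) (h4.trans h2.symm)
        (funext₂ h))
      simp [this]
    | succ q ih =>
      intro X Y h1 h2 h3 h4 h i j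
      have h5 := (map_dx_dy_eq_zero_iff φ X).2 ⟨h1, h2⟩
      rw [ih ⁅pairAlgebraDy A B, X⁆ Y rfl rfl h3 h4 (fun i j => by
        rw [pairAlgebraDy_lie_series h1 h2, h, add_assoc j]), LieEquiv.map_lie,
        lie_series_of_dx_dy_eq_zero _ h5.1 h5.2, map_pairAlgebraDy_dx, zero_smul, zero_add,
        smul_smul, pow_succ, add_assoc j, mul_assoc]
  | succ p ih =>
    intro q X Y h1 h2 h3 h4 h i j
    have h5 := (map_dx_dy_eq_zero_iff φ X).2 ⟨h1, h2⟩
    rw [ih q ⁅pairAlgebraDx A B, X⁆ Y rfl rfl h3 h4 (fun i j => by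
      rw [pairAlgebraDx_lie_series h1 h2, h, add_assoc i]), LieEquiv.map_lie,
      lie_series_of_dx_dy_eq_zero _ h5.1 h5.2, map_pairAlgebraDx_dy, zero_smul, add_zero,
      smul_smul, pow_succ, add_assoc i, mul_right_comm]

theorem monomial_zero_mem_pairAlgebra (v : PairCoeff F m) :
    (monomial 0 0 v : ShiftAlgebra F (PairCoeff F m)) ∈ pairAlgebra A B := by
  obtain ⟨w, t⟩ := v
  have e : ((w, t) : PairCoeff F m) = (w, 0) + (0, t) := by simp
  rw [e, monomial_add]
  exact add_mem (monomial_fst_mem_pairAlgebra_of_lt (by norm_num) w)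
    (monomial_snd_mem_pairAlgebra (by decide) t)

/-- The embedding of the constant series. -/
def pairAlgebraConst (A B : Matrix (Fin m) (Fin m) F) : PairCoeff F m →ₗ[F] pairAlgebra A B where
  toFun v := ⟨monomial 0 0 v, monomial_zero_mem_pairAlgebra v⟩
  map_add' v w := Subtype.ext (monomial_add 0 0 v w)
  map_smul' a v := Subtype.ext (monomial_smul 0 0 a v)

/-- Constant series are those killed by both derivations, so the isomorphism acts on them by a
linear map `ψ` of the coefficients. This `ψ` preserves the scalar line, and the induced map `f` on
the quotient respects the quintuples. -/
theorem pairSimilar_of_equiv_pairAlgebra [CharZero F]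
    (φ : pairAlgebra A B ≃ₗ⁅F⁆ pairAlgebra A' B') : PairSimilar A B A' B' := by
  obtain ⟨a, d, ha, hd, hφ⟩ := exists_map_series_eq φ
  let ev : pairAlgebra A' B' →ₗ[F] PairCoeff F m :=
    LinearMap.proj 0 ∘ₗ LinearMap.proj (φ := fun _ : ℕ => ℕ → PairCoeff F m) 0 ∘ₗ
      seriesₗ ∘ₗ (pairAlgebra A' B').toSubmodule.subtype
  let ψ : PairCoeff F m →ₗ[F] PairCoeff F m :=
    ev ∘ₗ (φ : pairAlgebra A B →ₗ[F] pairAlgebra A' B') ∘ₗ pairAlgebraConst A B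
  have hψ (v : PairCoeff F m) : ψ v = (φ (pairAlgebraConst A B v)).1.series 0 0 := rfl
  have hψ_inj : ∀ v, ψ v = 0 → v = 0 := by
    intro v hv
    have hdxy := (map_dx_dy_eq_zero_iff φ (pairAlgebraConst A B v)).2 ⟨rfl, rfl⟩
    have h1 : φ (pairAlgebraConst A B v) = 0 := by
      refine Subtype.ext (ShiftAlgebra.ext hdxy.1 hdxy.2 ?_)
      funext i j
      rcases i with _ | i
      · rcases j with _ | j
        · exact hv
        · have h := hφ 0 1 (pairAlgebraConst A B v) 0 rfl rfl rfl rfl (fun i j => by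
            change 0 = (monomial 0 0 v : ShiftAlgebra F (PairCoeff F m)).series _ _
            rw [monomial_series, if_neg (by omega)]) 0 j
          simpa [hd] using h.symm
      · have h := hφ 1 0 (pairAlgebraConst A B v) 0 rfl rfl rfl rfl (fun i j => by
          change 0 = (monomial 0 0 v : ShiftAlgebra F (PairCoeff F m)).series _ _
          rw [monomial_series, if_neg (by omega)]) i j
        simpa [ha] using h.symm
    have h2 : pairAlgebraConst A B v = 0 := EquivLike.injective φ (h1.trans (map_zero φ).symm)
    exact congrArg (fun X => X.1.series 0 0) h2
  -- The scalar line is obtained by applying `∂ₓ⁴ ∂ᵧ` to `x⁴y/4!`; its image is thus a coefficient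
  -- of degree 5, where the vector part vanishes.
  have hline : (ψ (0, 1)).1 = 0 := by
    rw [hψ, hφ 4 1 (pairAlgebraHook A B 4 1 (by decide)) _ rfl rfl rfl rfl (fun i j => by
      simp [pairAlgebraConst, pairAlgebraHook, monomial_series]), Prod.smul_fst,
      (φ _).2.1 _ _ (by norm_num), smul_zero]
  let f : (Fin 2 → Fin m → F) →ₗ[F] (Fin 2 → Fin m → F) :=
    LinearMap.fst F _ F ∘ₗ ψ ∘ₗ LinearMap.inl F _ F
  have hf (w : Fin 2 → Fin m → F) : f w = (ψ (w, 0)).1 := rfl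
  refine pairSimilar_of_map_range_pencilMap f ?_ ?_
  · rw [← LinearMap.ker_eq_bot, LinearMap.ker_eq_bot']
    intro w hw
    rw [hf] at hw
    have h1 : (ψ (0, 1)).2 ≠ 0 := fun h => one_ne_zero
      (congrArg Prod.snd (hψ_inj (0, 1) (Prod.ext hline h)))
    -- If `f w = 0`, then `ψ (w, 0)` and `ψ (0, 1)` lie on the same line, so this combination is
    -- killed by the injective `ψ`.
    have h2 := hψ_inj ((ψ (0, 1)).2 • (w, 0) - (ψ (w, 0)).2 • (0, 1)) (by
      rw [map_sub, map_smul, map_smul]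
      refine Prod.ext ?_ ?_
      · simp [hw, hline]
      · simp [mul_comm])
    have h3 := congrArg Prod.fst h2
    simpa [h1] using h3
  · intro k v
    -- The constant is the iterated derivative of a single monomial of degree 4, so its image is a
    -- multiple of a coefficient confined to the `k`-th subspace.
    rw [hf, hψ, hφ k.rev k ⟨_, monomial_fst_mem_pairAlgebra k v⟩ _ rfl rfl rfl rfl (fun i j => by
      simp [pairAlgebraConst, monomial_series]), zero_add, zero_add, Prod.smul_fst]
    exact Submodule.smul_mem _ _ ((φ _).2.2.1 k)

end Isomorphism

/-! ### Linear independence and reindexing of polynomial families. -/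

namespace ShiftAlgebra

variable {F V ι : Type*} [Field F] [AddCommGroup V] [Module F V]

theorem sum_dx (s : Finset ι) (f : ι → ShiftAlgebra F V) :
    (∑ i ∈ s, f i).dx = ∑ i ∈ s, (f i).dx := map_sum dxₗ f s

theorem sum_dy (s : Finset ι) (f : ι → ShiftAlgebra F V) :
    (∑ i ∈ s, f i).dy = ∑ i ∈ s, (f i).dy := map_sum dyₗ f s

theorem sum_series (s : Finset ι) (f : ι → ShiftAlgebra F V) :
    (∑ i ∈ s, f i).series = ∑ i ∈ s, (f i).series := map_sum seriesₗ f s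

end ShiftAlgebra

section Family

variable {F L : Type*} [Field F] [AddCommGroup L] [Module F L] {R S H : Type*}

/-- The vectors given by a matrix of noncommutative polynomials, with arbitrary finite index
types. -/
def ncVec [Fintype H] (c : R → L) (X : H → ℕ → L) (T : Matrix H S (FreeAlgebra F (Fin 2)))
    {m : ℕ} (A B : Matrix (Fin m) (Fin m) F) : R ⊕ (S × Fin m) → L :=
  Sum.elim c fun jk => ∑ l, ∑ q : Fin m, ncEval A B (T l jk.1) q jk.2 • X l q

/-- The vectors are linearly independent if the matrix contains an identity submatrix. -/
theorem linearIndependent_ncVec [Fintype R] [Fintype S] [Fintype H] [DecidableEq S]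
    {c : R → L} {X : H → ℕ → L}
    (hind : LinearIndependent F (Sum.elim c fun lq : H × ℕ => X lq.1 lq.2))
    {T : Matrix H S (FreeAlgebra F (Fin 2))} (row : S → H)
    (hrow : ∀ s s', T (row s) s' = if s = s' then 1 else 0)
    {m : ℕ} (A B : Matrix (Fin m) (Fin m) F) : LinearIndependent F (ncVec c X T A B) := by
  classical
  -- `ξ` reads off coordinates in the independent system; the coordinate at `(row s, q)` isolates
  -- the coefficient of the column `(s, q)`.
  obtain ⟨ξ, hξ⟩ := LinearMap.exists_leftInverse_of_injective
    (Finsupp.linearCombination F (Sum.elim c fun lq : H × ℕ => X lq.1 lq.2))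
    (LinearMap.ker_eq_bot.2 hind)
  have hξ' : ∀ i, ξ (Sum.elim c (fun lq : H × ℕ => X lq.1 lq.2) i) = Finsupp.single i 1 := by
    intro i
    have h := LinearMap.congr_fun hξ (Finsupp.single i 1)
    simpa using h
  have hc : ∀ i, ξ (c i) = Finsupp.single (Sum.inl i) 1 := fun i => hξ' (Sum.inl i)
  have hX : ∀ l q, ξ (X l q) = Finsupp.single (Sum.inr (l, q)) 1 := fun l q =>
    hξ' (Sum.inr (l, q))
  rw [Fintype.linearIndependent_iff]
  intro g hg
  rw [Fintype.sum_sum_type] at hg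
  have h := congrArg ξ hg
  simp only [ncVec, Sum.elim_inl, Sum.elim_inr, map_add, map_sum, map_smul, hc, hX, map_zero] at h
  rintro (i | ⟨s, q⟩)
  · have h' := DFunLike.congr_fun h (Sum.inl i)
    simpa [Finsupp.single_apply] using h'
  · have h' := DFunLike.congr_fun h (Sum.inr (row s, (q : ℕ)))
    have key : ∀ (s' : S) (k : Fin m), (∑ l, ∑ q' : Fin m, ncEval A B (T l s') q' k *
        if l = row s ∧ (q' : ℕ) = q then 1 else 0) = if s = s' ∧ q = k then 1 else 0 := by
      intro s' k
      rw [Finset.sum_eq_single (row s), Finset.sum_eq_single q]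
      · simp only [hrow]
        by_cases hs : s = s'
        · simp [hs, Matrix.one_apply]
        · simp [hs]
      · intro q' _ hq'
        rw [if_neg fun h => hq' (Fin.ext h.2), mul_zero]
      · simp
      · intro l _ hl
        exact Finset.sum_eq_zero fun q' _ => by rw [if_neg fun h => hl h.1, mul_zero]
      · simp
    simp only [Finsupp.add_apply, Finsupp.finsetSum_apply, Finsupp.smul_apply,
      Finsupp.single_apply, reduceCtorEq, if_false, Sum.inr.injEq, Prod.mk.injEq, smul_eq_mul,
      mul_zero, Finset.sum_const_zero, zero_add, key, Fintype.sum_prod_type,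
      Finsupp.coe_zero, Pi.zero_apply] at h'
    rw [Finset.sum_eq_single s, Finset.sum_eq_single q] at h'
    · simpa using h'
    · intro k _ hk
      rw [if_neg fun h => hk h.2.symm, mul_zero]
    · simp
    · intro s' _ hs'
      exact Finset.sum_eq_zero fun k _ => by rw [if_neg fun h => hs' h.1.symm, mul_zero]
    · simp

end Family

/-- Wildness follows from a family with arbitrary finite index types. -/
theorem NilpotentSubalgebraProblemIsWild.of_fintype {F L : Type*} [Field F] [LieRing L]
    [LieAlgebra F L] {R S H : Type*} [Fintype R] [Fintype S] [Fintype H] (c : R → L)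
    (X : H → ℕ → L) (hind : LinearIndependent F (Sum.elim c fun lq : H × ℕ => X lq.1 lq.2))
    (T : Matrix H S (FreeAlgebra F (Fin 2)))
    (g : ∀ m : ℕ, Matrix (Fin m) (Fin m) F → Matrix (Fin m) (Fin m) F → LieSubalgebra F L)
    (hg : ∀ (m : ℕ) (A B : Matrix (Fin m) (Fin m) F),
      LinearIndependent F (ncVec c X T A B) ∧
      (g m A B).toSubmodule = Submodule.span F (Set.range (ncVec c X T A B)) ∧
      LieRing.IsNilpotent (g m A B))
    (hiso : ∀ (m : ℕ) (A B A' B' : Matrix (Fin m) (Fin m) F),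
      PairSimilar A B A' B' ↔ Nonempty (g m A B ≃ₗ⁅F⁆ g m A' B')) :
    NilpotentSubalgebraProblemIsWild F L := by
  let eR := (Fintype.equivFin R).symm
  let eS := (Fintype.equivFin S).symm
  let eH := (Fintype.equivFin H).symm
  let Φ : NCFamily F L :=
    { r := Fintype.card R
      s := Fintype.card S
      h := Fintype.card H
      c := fun i => c (eR i)
      X := fun l => X (eH l)
      indep := by
        convert hind.comp (Equiv.sumCongr eR (Equiv.prodCongr eH (Equiv.refl ℕ)))
          (Equiv.injective _) using 1
        funext i
        rcases i with i | i <;> rfl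
      T := T.submatrix eH eS }
  have hΦ : ∀ {m : ℕ} (A B : Matrix (Fin m) (Fin m) F), Φ.vec A B =
      ncVec c X T A B ∘ Equiv.sumCongr eR (Equiv.prodCongr eS (Equiv.refl (Fin m))) := by
    intro m A B
    funext i
    rcases i with i | ⟨j, k⟩
    · rfl
    · exact Equiv.sum_comp eH fun l => ∑ q : Fin m, ncEval A B (T l (eS j)) q k • X l q
  refine ⟨Φ, g, fun m A B => ?_, hiso⟩
  obtain ⟨h1, h2, h3⟩ := hg m A B
  refine ⟨?_, ?_, h3⟩
  · rw [hΦ]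
    exact h1.comp _ (Equiv.injective _)
  · rw [hΦ, EquivLike.range_comp, h2]

/-! ### Realizing the algebra of a pair inside a Lie algebra with monomial fields. -/

/-- Elements of a Lie algebra that multiply as `∂/∂x`, `∂/∂y`, and the vector fields
`xⁱ / i! * yʲ / j! * zᵏ ∂/∂w`. -/
structure MonomialSystem (F L : Type*) [Field F] [LieRing L] [LieAlgebra F L] where
  dx : L
  dy : L
  mono : ℕ → ℕ → ℕ → L
  indep : LinearIndependent F
    (Sum.elim ![dx, dy] fun t : ℕ × ℕ × ℕ => mono t.1 t.2.1 t.2.2)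
  dx_lie_dy : ⁅dx, dy⁆ = 0
  dx_lie_zero : ∀ j k, ⁅dx, mono 0 j k⁆ = 0
  dx_lie_succ : ∀ i j k, ⁅dx, mono (i + 1) j k⁆ = mono i j k
  dy_lie_zero : ∀ i k, ⁅dy, mono i 0 k⁆ = 0
  dy_lie_succ : ∀ i j k, ⁅dy, mono i (j + 1) k⁆ = mono i j k
  mono_lie_mono : ∀ i j k i' j' k', ⁅mono i j k, mono i' j' k'⁆ = 0

namespace MonomialSystem

variable {F L : Type*} [Field F] [LieRing L] [LieAlgebra F L] (σ : MonomialSystem F L) {m : ℕ}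

/-- Indices of the constant vectors: the two derivations and the hook monomials. -/
abbrev ConstIndex : Type := Fin 2 ⊕ {p : Fin 5 × Fin 6 // IsHookExponent p.1 p.2}

/-- Indices of the block columns: the monomials of degree less than `4`, and the five pencils. -/
abbrev ColIndex : Type := ({p : Fin 5 × Fin 5 // (p.1 : ℕ) + p.2 < 4} × Fin 2) ⊕ Fin 5

/-- Indices of the block rows. -/
abbrev RowIndex : Type := (Fin 5 × Fin 5) × Fin 2

/-- The constant vectors. -/
def const : ConstIndex → L := Sum.elim ![σ.dx, σ.dy] fun p => σ.mono p.1.1 p.1.2 0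

/-- The vectors of the coordinate system. -/
def coord (h : RowIndex) (q : ℕ) : L := σ.mono h.1.1 h.1.2 (2 * q + h.2 + 1)

/-- The matrix of noncommutative polynomials. -/
def colMatrix (F : Type*) [Field F] : Matrix RowIndex ColIndex (FreeAlgebra F (Fin 2)) :=
  Matrix.of fun h => Sum.elim (fun t => if h = (t.1.1, t.2) then 1 else 0)
    fun k => if h.1 = (k.rev, k) then pencil F k h.2 else 0

/-- The exponent 0 of `z` is reserved for the scalar line, and `2q + ε + 1` encodes entry `q` of
vector `ε` independently of `m`. Distinct indices therefore give distinct monomials. -/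
theorem linearIndependent_const_coord : LinearIndependent F
    (Sum.elim σ.const fun lq : RowIndex × ℕ => σ.coord lq.1 lq.2) := by
  let idx : ConstIndex ⊕ (RowIndex × ℕ) → Fin 2 ⊕ (ℕ × ℕ × ℕ) :=
    Sum.elim (Sum.map id fun p => (p.1.1, p.1.2, 0))
      fun lq => Sum.inr (lq.1.1.1, lq.1.1.2, 2 * lq.2 + lq.1.2 + 1)
  have hidx : Function.Injective idx := by
    rintro ((a | ⟨⟨p, q⟩, hp⟩) | ⟨⟨⟨i, j⟩, ε⟩, q⟩) ((a' | ⟨⟨p', q'⟩, hp'⟩) | ⟨⟨⟨i', j'⟩, ε'⟩, q'⟩) h <;>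
    simp [idx] at h ⊢
    · exact h
    · exact ⟨Fin.ext h.1, Fin.ext h.2⟩
    · have := ε.isLt
      have := ε'.isLt
      exact ⟨⟨⟨Fin.ext h.1, Fin.ext h.2.1⟩, Fin.ext (by omega)⟩, by omega⟩
  have e : (Sum.elim σ.const fun lq : RowIndex × ℕ => σ.coord lq.1 lq.2) =
      (Sum.elim ![σ.dx, σ.dy] fun t : ℕ × ℕ × ℕ => σ.mono t.1 t.2.1 t.2.2) ∘ idx := by
    funext i
    rcases i with (i | i) | i <;> rfl
  rw [e]
  exact σ.indep.comp idx hidx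

/-- The rows of an identity submatrix of `colMatrix`. -/
def pivotRow : ColIndex → RowIndex :=
  Sum.elim (fun t => (t.1.1, t.2)) fun k => ((k.rev, k), if k = 1 then 1 else 0)

/-- Every pencil except `(0, 1)` has first entry 1, so only that one takes its pivot in the second
component. -/
theorem colMatrix_pivotRow (s s' : ColIndex) :
    colMatrix F (pivotRow s) s' = if s = s' then 1 else 0 := by
  rcases s with ⟨p, ε⟩ | k <;> rcases s' with ⟨p', ε'⟩ | k'
  · simp [colMatrix, pivotRow, Subtype.ext_iff]
  · have h : p.1 ≠ (k'.rev, k') := by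
      intro h
      have h' := p.2
      rw [h, Fin.val_rev] at h'
      dsimp only at h'
      omega
    simp [colMatrix, pivotRow, h]
  · have h : (k.rev, k) ≠ p'.1 := by
      intro h
      have h' := p'.2
      rw [← h, Fin.val_rev] at h'
      dsimp only at h'
      omega
    simp [colMatrix, pivotRow, h]
  · by_cases h : k = k'
    · subst h
      fin_cases k <;> simp [colMatrix, pivotRow, pencil]
    · simp [colMatrix, pivotRow, h]

/-- The embedding of the coefficients of the monomial `xⁱ / i! * yʲ / j!`. -/
def coeffEmb (i j : ℕ) : PairCoeff F m →ₗ[F] L where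
  toFun v := v.2 • σ.mono i j 0 + ∑ ε : Fin 2, ∑ q : Fin m, v.1 ε q • σ.mono i j (2 * q + ε + 1)
  map_add' v w := by
    simp only [Prod.fst_add, Prod.snd_add, Pi.add_apply, add_smul, Finset.sum_add_distrib]
    abel
  map_smul' a v := by
    simp only [Prod.smul_fst, Prod.smul_snd, Pi.smul_apply, smul_add, Finset.smul_sum, smul_smul,
      smul_eq_mul, RingHom.id_apply]

theorem coeffEmb_apply (i j : ℕ) (v : PairCoeff F m) : σ.coeffEmb i j v =
    v.2 • σ.mono i j 0 + ∑ ε : Fin 2, ∑ q : Fin m, v.1 ε q • σ.mono i j (2 * q + ε + 1) := rfl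

theorem dx_lie_coeffEmb_succ (i j : ℕ) (v : PairCoeff F m) :
    ⁅σ.dx, σ.coeffEmb (i + 1) j v⁆ = σ.coeffEmb i j v := by
  simp only [coeffEmb_apply, lie_add, lie_sum, lie_smul, σ.dx_lie_succ]

theorem dx_lie_coeffEmb_zero (j : ℕ) (v : PairCoeff F m) : ⁅σ.dx, σ.coeffEmb 0 j v⁆ = 0 := by
  simp only [coeffEmb_apply, lie_add, lie_sum, lie_smul, σ.dx_lie_zero, smul_zero,
    Finset.sum_const_zero, add_zero]

theorem dy_lie_coeffEmb_succ (i j : ℕ) (v : PairCoeff F m) :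
    ⁅σ.dy, σ.coeffEmb i (j + 1) v⁆ = σ.coeffEmb i j v := by
  simp only [coeffEmb_apply, lie_add, lie_sum, lie_smul, σ.dy_lie_succ]

theorem dy_lie_coeffEmb_zero (i : ℕ) (v : PairCoeff F m) : ⁅σ.dy, σ.coeffEmb i 0 v⁆ = 0 := by
  simp only [coeffEmb_apply, lie_add, lie_sum, lie_smul, σ.dy_lie_zero, smul_zero,
    Finset.sum_const_zero, add_zero]

theorem coeffEmb_lie_coeffEmb (i j i' j' : ℕ) (v w : PairCoeff F m) :
    ⁅σ.coeffEmb i j v, σ.coeffEmb i' j' w⁆ = 0 := by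
  simp only [coeffEmb_apply, lie_add, add_lie, lie_sum, sum_lie, lie_smul, smul_lie,
    σ.mono_lie_mono, smul_zero, Finset.sum_const_zero, add_zero]

/-- The embedding of the series whose exponents are less than `6`. -/
def seriesEmb : (ℕ → ℕ → PairCoeff F m) →ₗ[F] L where
  toFun u := ∑ i ∈ Finset.range 6, ∑ j ∈ Finset.range 6, σ.coeffEmb i j (u i j)
  map_add' u v := by
    simp only [Pi.add_apply, map_add, Finset.sum_add_distrib]
  map_smul' a u := by
    simp only [Pi.smul_apply, map_smul, Finset.smul_sum, RingHom.id_apply]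

theorem seriesEmb_apply (u : ℕ → ℕ → PairCoeff F m) : σ.seriesEmb u =
    ∑ i ∈ Finset.range 6, ∑ j ∈ Finset.range 6, σ.coeffEmb i j (u i j) := rfl

/-- The derivation shifts the sum down: the slice `i = 0` dies, and the slice entering at the top of
the window is zero by `hu`. -/
theorem dx_lie_seriesEmb {u : ℕ → ℕ → PairCoeff F m} (hu : ∀ j, u 6 j = 0) :
    ⁅σ.dx, σ.seriesEmb u⁆ = σ.seriesEmb fun i j => u (i + 1) j := by
  conv_lhs => rw [seriesEmb_apply, Finset.sum_range_succ']
  conv_rhs => rw [seriesEmb_apply, Finset.sum_range_succ]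
  simp only [lie_add, lie_sum, dx_lie_coeffEmb_succ, dx_lie_coeffEmb_zero, hu, map_zero,
    Finset.sum_const_zero]

theorem dy_lie_seriesEmb {u : ℕ → ℕ → PairCoeff F m} (hu : ∀ i, u i 6 = 0) :
    ⁅σ.dy, σ.seriesEmb u⁆ = σ.seriesEmb fun i j => u i (j + 1) := by
  rw [seriesEmb_apply, seriesEmb_apply, lie_sum]
  refine Finset.sum_congr rfl fun i _ => ?_
  conv_lhs => rw [Finset.sum_range_succ']
  conv_rhs => rw [Finset.sum_range_succ]
  simp only [lie_add, lie_sum, dy_lie_coeffEmb_succ, dy_lie_coeffEmb_zero, hu, map_zero]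

theorem seriesEmb_lie_seriesEmb (u v : ℕ → ℕ → PairCoeff F m) :
    ⁅σ.seriesEmb u, σ.seriesEmb v⁆ = 0 := by
  simp only [seriesEmb_apply, lie_sum, sum_lie, coeffEmb_lie_coeffEmb,
    Finset.sum_const_zero]

/-- The linear map to `L` that respects brackets of polynomials of small degree. -/
def emb : ShiftAlgebra F (PairCoeff F m) →ₗ[F] L :=
  dxₗ.smulRight σ.dx + dyₗ.smulRight σ.dy + σ.seriesEmb ∘ₗ seriesₗ

theorem emb_apply (X : ShiftAlgebra F (PairCoeff F m)) :
    σ.emb X = X.dx • σ.dx + X.dy • σ.dy + σ.seriesEmb X.series := rfl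

theorem dy_lie_dx : ⁅σ.dy, σ.dx⁆ = 0 := by rw [← lie_skew, σ.dx_lie_dy, neg_zero]

/-- Truncation to exponents below 6 is harmless here, since elements of `pairAlgebra A B` have
degree at most 5. -/
theorem emb_lie {A B : Matrix (Fin m) (Fin m) F} {X Y : ShiftAlgebra F (PairCoeff F m)}
    (hX : X ∈ pairAlgebra A B) (hY : Y ∈ pairAlgebra A B) :
    σ.emb ⁅X, Y⁆ = ⁅σ.emb X, σ.emb Y⁆ := by
  have hx {Z : ShiftAlgebra F (PairCoeff F m)} (hZ : Z ∈ pairAlgebra A B) :=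
    σ.dx_lie_seriesEmb fun j => series_eq_zero_of_mem_pairAlgebra hZ (i := 6) (j := j) (by omega)
  have hy {Z : ShiftAlgebra F (PairCoeff F m)} (hZ : Z ∈ pairAlgebra A B) :=
    σ.dy_lie_seriesEmb fun i => series_eq_zero_of_mem_pairAlgebra hZ (i := i) (j := 6) (by omega)
  have hd (a b : F) (u : ℕ → ℕ → PairCoeff F m) : σ.seriesEmb (dirDeriv a b u) =
      a • (σ.seriesEmb fun i j => u (i + 1) j) + b • σ.seriesEmb fun i j => u i (j + 1) := by
    rw [← map_smul, ← map_smul, ← map_add]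
    rfl
  rw [emb_apply, emb_apply, emb_apply, lie_series, map_sub, hd, hd, ← hx hX, ← hx hY, ← hy hX,
    ← hy hY, lie_dx, lie_dy]
  simp only [lie_add, add_lie, lie_smul, smul_lie, lie_self, σ.dx_lie_dy, σ.dy_lie_dx,
    seriesEmb_lie_seriesEmb, ← lie_skew σ.dx (σ.seriesEmb _), ← lie_skew σ.dy (σ.seriesEmb _)]
  module

/-- The basis of the Lie algebra of a pair. -/
def pairBasis (A B : Matrix (Fin m) (Fin m) F) :
    ConstIndex ⊕ (ColIndex × Fin m) → ShiftAlgebra F (PairCoeff F m)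
  | Sum.inl (Sum.inl i) => ⟨![1, 0] i, ![0, 1] i, 0⟩
  | Sum.inl (Sum.inr p) => monomial p.1.1 p.1.2 (0, 1)
  | Sum.inr (Sum.inl t, q) => monomial t.1.1.1 t.1.1.2 (Pi.single t.2 (Pi.single q 1), 0)
  | Sum.inr (Sum.inr k, q) => monomial k.rev k (pencilMap A B k (Pi.single q 1), 0)

theorem pairBasis_mem (A B : Matrix (Fin m) (Fin m) F) (i : ConstIndex ⊕ (ColIndex × Fin m)) :
    pairBasis A B i ∈ pairAlgebra A B := by
  rcases i with (i | p) | ⟨t | k, q⟩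
  · exact mk_zero_series_mem_pairAlgebra _ _
  · exact monomial_snd_mem_pairAlgebra p.2 1
  · exact monomial_fst_mem_pairAlgebra_of_lt t.1.2 _
  · exact monomial_fst_mem_pairAlgebra k _

theorem emb_monomial {i j : ℕ} (hi : i < 6) (hj : j < 6) (v : PairCoeff F m) :
    σ.emb (monomial i j v) = σ.coeffEmb i j v := by
  rw [emb_apply, monomial_dx, monomial_dy, zero_smul, zero_smul, zero_add, zero_add,
    seriesEmb_apply, Finset.sum_eq_single_of_mem i (Finset.mem_range.2 hi),
    Finset.sum_eq_single_of_mem j (Finset.mem_range.2 hj)]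
  · simp [monomial_series]
  · intro j' _ h
    rw [monomial_series, if_neg fun h' => h h'.2, map_zero]
  · intro i' _ h
    exact Finset.sum_eq_zero fun j' _ => by
      rw [monomial_series, if_neg fun h' => h h'.1, map_zero]

theorem emb_pairBasis (A B : Matrix (Fin m) (Fin m) F) (i : ConstIndex ⊕ (ColIndex × Fin m)) :
    σ.emb (pairBasis A B i) = ncVec σ.const σ.coord (colMatrix F) A B i := by
  rcases i with (i | p) | ⟨t | k, q⟩
  · fin_cases i <;> simp [emb_apply, pairBasis, ncVec, const]
  · rw [pairBasis, σ.emb_monomial (by omega) (by omega)]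
    simp [coeffEmb_apply, ncVec, const]
  · rw [pairBasis, σ.emb_monomial (by omega) (by omega), coeffEmb_apply]
    simp only [ncVec, Sum.elim_inr, zero_smul, zero_add]
    rw [Finset.sum_eq_single t.2, Finset.sum_eq_single q, Finset.sum_eq_single (t.1.1, t.2),
      Finset.sum_eq_single q]
    · simp [colMatrix, coord]
    · intro q' _ h
      simp [colMatrix, h]
    · simp
    · intro l _ h
      simp [colMatrix, h]
    · simp
    · intro q' _ h
      simp [h]
    · simp
    · intro ε _ h
      simp [h]
    · simp
  · rw [pairBasis, σ.emb_monomial (by omega) (by omega), coeffEmb_apply]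
    simp only [ncVec, Sum.elim_inr, zero_smul, zero_add]
    rw [Fintype.sum_prod_type, Finset.sum_eq_single (k.rev, k)]
    · simp [colMatrix, coord, pencilMap]
    · intro l _ h
      simp [colMatrix, h]
    · simp

theorem eq_sum_monomial {A B : Matrix (Fin m) (Fin m) F} {X : ShiftAlgebra F (PairCoeff F m)}
    (hX : X ∈ pairAlgebra A B) : X = X.dx • pairBasis A B (Sum.inl (Sum.inl 0)) +
      X.dy • pairBasis A B (Sum.inl (Sum.inl 1)) +
      ∑ p ∈ Finset.range 6 ×ˢ Finset.range 6, monomial p.1 p.2 (X.series p.1 p.2) := by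
  refine ShiftAlgebra.ext ?_ ?_ ?_
  · simp [sum_dx, pairBasis]
  · simp [sum_dy, pairBasis]
  · funext i j
    rw [add_series, sum_series, Pi.add_apply, Pi.add_apply, Finset.sum_apply, Finset.sum_apply]
    have h0 : (X.dx • pairBasis A B (Sum.inl (Sum.inl 0)) +
        X.dy • pairBasis A B (Sum.inl (Sum.inl 1))).series = 0 := by
      simp [pairBasis]
    rw [h0, Pi.zero_apply, Pi.zero_apply, zero_add]
    by_cases h : (i, j) ∈ Finset.range 6 ×ˢ Finset.range 6
    · rw [Finset.sum_eq_single_of_mem (i, j) h]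
      · simp [monomial_series]
      · rintro ⟨i', j'⟩ _ h'
        rw [monomial_series, if_neg]
        rintro ⟨rfl, rfl⟩
        exact h' rfl
    · rw [Finset.sum_eq_zero]
      · refine series_eq_zero_of_mem_pairAlgebra hX ?_
        simp only [Finset.mem_product, Finset.mem_range] at h
        omega
      · rintro ⟨i', j'⟩ h'
        rw [monomial_series, if_neg]
        rintro ⟨rfl, rfl⟩
        exact h h'

theorem span_pairBasis (A B : Matrix (Fin m) (Fin m) F) :
    Submodule.span F (Set.range (pairBasis A B)) = (pairAlgebra A B).toSubmodule := by
  apply le_antisymm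
  · rw [Submodule.span_le]
    rintro _ ⟨i, rfl⟩
    exact pairBasis_mem A B i
  · intro X hX
    have hb : ∀ i, pairBasis A B i ∈ Submodule.span F (Set.range (pairBasis A B)) :=
      fun i => Submodule.subset_span ⟨i, rfl⟩
    rw [eq_sum_monomial hX]
    refine add_mem (add_mem (Submodule.smul_mem _ _ (hb _)) (Submodule.smul_mem _ _ (hb _)))
      (Submodule.sum_mem _ ?_)
    rintro ⟨i, j⟩ hij
    simp only [Finset.mem_product, Finset.mem_range] at hij
    have e : X.series i j = ((X.series i j).1, 0) + (X.series i j).2 • (0, 1) := by simp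
    dsimp only
    rw [e, monomial_add, monomial_smul]
    refine add_mem ?_ ?_
    -- Vector coefficients below degree 4 are arbitrary, in degree 4 they come from the pencil maps,
    -- and above it they vanish.
    · rcases lt_trichotomy (i + j) 4 with h | h | h
      · have e : (((X.series i j).1, 0) : PairCoeff F m) = ∑ ε, ∑ q, (X.series i j).1 ε q •
            (Pi.single ε (Pi.single q 1), 0) := by
          ext ε q
          · fin_cases ε <;> simp [Prod.fst_sum, Finset.sum_apply, Pi.single_apply]
          · simp [Prod.snd_sum]
        rw [e]
        change monomialₗ i j _ ∈ _
        simp only [map_sum, map_smul]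
        exact Submodule.sum_mem _ fun ε _ => Submodule.sum_mem _ fun q _ =>
          Submodule.smul_mem _ _
            (hb (Sum.inr (Sum.inl (⟨(⟨i, by omega⟩, ⟨j, by omega⟩), h⟩, ε), q)))
      · obtain ⟨k, rfl⟩ : ∃ k : Fin 5, (k : ℕ) = j := ⟨⟨j, by omega⟩, rfl⟩
        obtain rfl : i = k.rev := by rw [Fin.val_rev]; omega
        obtain ⟨v, hv⟩ := hX.2.1 k
        rw [← hv]
        have e : ((pencilMap A B k v, 0) : PairCoeff F m) = ∑ q, v q •
            (pencilMap A B k (Pi.single q 1), 0) := by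
          refine Prod.ext ?_ ?_
          · rw [Prod.fst_sum]
            conv_lhs => rw [pi_eq_sum_univ' v]
            simp only [map_sum, map_smul, Prod.smul_fst]
          · simp [Prod.snd_sum]
        rw [e]
        change monomialₗ _ _ _ ∈ _
        simp only [map_sum, map_smul]
        exact Submodule.sum_mem _ fun q _ =>
          Submodule.smul_mem _ _ (hb (Sum.inr (Sum.inr k, q)))
      · rw [hX.1 i j h]
        change monomialₗ _ _ (0 : PairCoeff F m) ∈ _
        rw [map_zero]
        exact zero_mem _
    · by_cases h : IsHookExponent i j
      · have hi : i < 5 := by unfold IsHookExponent at h; omega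
        exact Submodule.smul_mem _ _ (hb (Sum.inl (Sum.inr ⟨(⟨i, hi⟩, ⟨j, hij.2⟩), h⟩)))
      · rw [hX.2.2 i j h, zero_smul]
        exact zero_mem _

theorem linearIndependent_vec (A B : Matrix (Fin m) (Fin m) F) :
    LinearIndependent F (ncVec σ.const σ.coord (colMatrix F) A B) :=
  linearIndependent_ncVec σ.linearIndependent_const_coord pivotRow colMatrix_pivotRow A B

/-- The embedding of the Lie algebra of a pair. -/
def pairEmb (A B : Matrix (Fin m) (Fin m) F) : pairAlgebra A B →ₗ⁅F⁆ L where
  toLinearMap := σ.emb ∘ₗ (pairAlgebra A B).toSubmodule.subtype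
  map_lie' {X Y} := σ.emb_lie X.2 Y.2

theorem emb_comp_pairBasis (A B : Matrix (Fin m) (Fin m) F) :
    σ.emb ∘ pairBasis A B = ncVec σ.const σ.coord (colMatrix F) A B :=
  funext (σ.emb_pairBasis A B)

/-- The embedding sends a spanning family to a linearly independent one. -/
theorem pairEmb_injective (A B : Matrix (Fin m) (Fin m) F) :
    Function.Injective (σ.pairEmb A B) := by
  rw [injective_iff_map_eq_zero]
  intro X hX
  have hX' : σ.emb X.1 = 0 := hX
  have hmem : X.1 ∈ Submodule.span F (Set.range (pairBasis A B)) := by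
    rw [span_pairBasis]
    exact X.2
  obtain ⟨g, hg⟩ := (Submodule.mem_span_range_iff_exists_fun F).1 hmem
  rw [← hg, map_sum] at hX'
  simp only [map_smul, emb_pairBasis] at hX'
  have h0 := Fintype.linearIndependent_iff.1 (σ.linearIndependent_vec A B) g hX'
  refine Subtype.ext ?_
  rw [← hg]
  simp [h0]

theorem range_pairEmb (A B : Matrix (Fin m) (Fin m) F) :
    (σ.pairEmb A B).range.toSubmodule =
      Submodule.span F (Set.range (ncVec σ.const σ.coord (colMatrix F) A B)) := by
  rw [← emb_comp_pairBasis, Set.range_comp, ← Submodule.map_span, span_pairBasis]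
  ext x
  constructor
  · rintro ⟨X, rfl⟩
    exact ⟨X.1, X.2, rfl⟩
  · rintro ⟨X, hX, rfl⟩
    exact ⟨⟨X, hX⟩, rfl⟩

/-- The isomorphism of the Lie algebra of a pair with its image. -/
noncomputable def pairEquiv (A B : Matrix (Fin m) (Fin m) F) :
    pairAlgebra A B ≃ₗ⁅F⁆ (σ.pairEmb A B).range :=
  LieEquiv.ofInjective _ (σ.pairEmb_injective A B)

/-- Classifying nilpotent subalgebras of a Lie algebra with a monomial system is wild. -/
theorem nilpotentSubalgebraProblemIsWild [CharZero F] (σ : MonomialSystem F L) :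
    NilpotentSubalgebraProblemIsWild F L := by
  refine .of_fintype σ.const σ.coord σ.linearIndependent_const_coord (colMatrix F)
    (fun m A B => (σ.pairEmb A B).range) (fun m A B => ⟨σ.linearIndependent_vec A B,
    σ.range_pairEmb A B, ?_⟩) fun m A B A' B' => ⟨fun h => ?_, fun ⟨φ⟩ => ?_⟩
  · exact (LieEquiv.nilpotent_iff_equiv_nilpotent (σ.pairEquiv A B)).1 inferInstance
  · obtain ⟨φ⟩ := h.nonempty_equiv_pairAlgebra
    exact ⟨((σ.pairEquiv A B).symm.trans φ).trans (σ.pairEquiv A' B')⟩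
  · exact pairSimilar_of_equiv_pairAlgebra
      (((σ.pairEquiv A B).trans φ).trans (σ.pairEquiv A' B').symm)

end MonomialSystem

/-! ### Application to analytic vector fields. -/

namespace AnalyticVectorField

variable {n : ℕ} {x y z w : Fin n}

/-- The monomial vector fields in four of the variables. -/
noncomputable def monomialSystem (hxy : x ≠ y) (hxz : x ≠ z) (hyz : y ≠ z) (hxw : x ≠ w)
    (hyw : y ≠ w) (hzw : z ≠ w) : MonomialSystem ℝ (AnalyticVectorField n) where
  dx := partialField x
  dy := partialField y
  mono := monomialField x y z w
  indep := linearIndependent_partialField_monomialField hxy hxz hyz hxw hyw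
  dx_lie_dy := partialField_lie_partialField x y
  dx_lie_zero := partialField_lie_monomialField_zero_left hxy hxz
  dx_lie_succ := partialField_lie_monomialField_succ_left hxy hxz
  dy_lie_zero i k := by
    rw [monomialField_swap, partialField_lie_monomialField_zero_left hxy.symm hyz]
  dy_lie_succ i j k := by
    rw [monomialField_swap, partialField_lie_monomialField_succ_left hxy.symm hyz,
      monomialField_swap]
  mono_lie_mono := monomialField_lie_monomialField hxw hyw hzw

end AnalyticVectorField

theorem corollary2 (n : ℕ) (hn : 4 ≤ n) :
    NilpotentSubalgebraProblemIsWild ℝ (AnalyticVectorField n) := by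
  have h (a b : Fin 4) (hab : a ≠ b) : Fin.castLE hn a ≠ Fin.castLE hn b :=
    fun h => hab (Fin.castLE_injective hn h)
  -- Four distinct variables are needed: two to differentiate, one to carry coefficients, one for
  -- the direction of the fields.
  exact (AnalyticVectorField.monomialSystem (h 0 1 (by decide)) (h 0 2 (by decide))
    (h 1 2 (by decide)) (h 0 3 (by decide)) (h 1 3 (by decide))
    (h 2 3 (by decide))).nilpotentSubalgebraProblemIsWild
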